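/- Let $d\ge 2$ and let $G$ be a finite nonempty undirected $(d+1)$-regular graph, possibly with loops (a loop contributes two to the degree) and multiple edges; $G$ is not assumed to be connected. Let $\overline E$ be the set of oriented edges of $G$: every edge, a loop included, gives two mutually inverse oriented edges $e,e^{-1}$, and $o(e),t(e)$ denote the origin and the terminal vertex of $e$. The non-backtracking edge subshift of $G$ is $$E_G=\{(e_n)_{n\in\mathbb Z}\in\overline E^{\,\mathbb Z}:\ t(e_n)=o(e_{n+1})\text{ and }e_{n+1}\ne e_n^{-1}\text{ for all }n\in\mathbb Z\},$$ with the shift $\sigma$ given by $(\sigma x)_n=x_{n+1}$. Let $H$ be its $0$-$1$ transition matrix, $H_{e,f}=1$ if and only if $t(e)=o(f)$ and $f\neq e^{-1}$, and let $\mu$ be the Markov measure on $E_G$ with transition matrix $\tfrac1d H$ and uniform stationary distribution on $\overline E$. Thus $\mu$ gives mass $\frac{1}{|\overline E|\,d^{k}}$ to each cylinder set given by an admissible word of $k+1$ consecutive letters. Then the following two statements are equivalent. 1. The system $(E_G,\sigma,\mu)$ is strongly mixing, that is, $\lim_{n\to\infty}\int (f\circ\sigma^n)\,g\,d\mu=\int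 f\,d\mu\int g\,d\mu$ for all $f,g\in L^2(E_G,\mu)$; and for any locally constant functions $f,g:E_G\to\mathbb C$ there exists a constant $C>0$ such that $$\left|\int_{E_G} (f\circ\sigma^n)\,g\,d\mu-\int_{E_G} f\,d\mu\int_{E_G} g\,d\mu\right|\le C\,n\left(\tfrac1{\sqrt d}\right)^{n}\qquad\text{for all integers } n\ge 1.$$ 2. $G$ is a non-bipartite Ramanujan graph, that is, $G$ is connected, every eigenvalue $\lambda$ of its adjacency matrix satisfies $\lambda=\pm(d+1)$ or $|\lambda|\le 2\sqrt d$, and $G$ is not bipartite. (A loop at $v$ contributes $2$ to the diagonal entry of the adjacency matrix at $v$.) -/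

import Mathlib

open MeasureTheory Filter Topology
open scoped NNReal ENNReal Graph

/-! ### One-dimensional subshifts of finite type -/

section Subshift

/-- The two-sided subshift of finite type `X_A` defined by a `0`-`1` transition matrix `A`.
It carries the subspace topology and Borel structure of the product `ℤ → V`. -/
def sftSet {V : Type*} (A : Matrix V V ℕ) : Set (ℤ → V) :=
  {x | ∀ i : ℤ, A (x i) (x (i + 1)) = 1}

/-- The shift map `σ`, `(σ x) i = x (i + 1)`, on `X_A`. -/
def sftShift {V : Type*} (A : Matrix V V ℕ) (x : sftSet A) : sftSet A :=
  ⟨fun i => x.1 (i + 1), fun i => x.2 (i + 1)⟩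

/-- A transition matrix is `d`-regular if its entries are `0` or `1` and all its rows and all its
columns sum to `d`. -/
structure IsRegularTransition {V : Type*} [Fintype V] (A : Matrix V V ℕ) (d : ℕ) : Prop where
  zero_or_one : ∀ u v, A u v = 0 ∨ A u v = 1
  row_sum : ∀ u, ∑ v, A u v = d
  col_sum : ∀ v, ∑ u, A u v = d

/-- The cylinder set of all `x` with `x (a + i) = w i` for `0 ≤ i ≤ k`. -/
def sftCylinder {V : Type*} (A : Matrix V V ℕ) (a : ℤ) (k : ℕ) (w : ℕ → V) : Set (sftSet A) :=
  {x | ∀ i : ℕ, i ≤ k → x.1 (a + i) = w i}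

/-- `μ` is the Markov measure on `X_A` given by the transition probabilities `P` and the initial
distribution `p`. -/
def IsMarkovMeasure {V : Type*} [MeasurableSpace V] {A : Matrix V V ℕ}
    (P : Matrix V V ℝ≥0) (p : V → ℝ≥0) (μ : Measure (sftSet A)) : Prop :=
  ∀ (a : ℤ) (k : ℕ) (w : ℕ → V),
    μ (sftCylinder A a k w) =
      ((p (w 0) * ∏ i ∈ Finset.range k, P (w i) (w (i + 1)) : ℝ≥0) : ℝ≥0∞)

/-- `μ` is the Markov measure of the stochastic matrix `d⁻¹ A` with its uniform stationary
distribution. -/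
def IsUniformMarkovMeasure {V : Type*} [Fintype V] [MeasurableSpace V] (A : Matrix V V ℕ) (d : ℕ)
    (μ : Measure (sftSet A)) : Prop :=
  IsMarkovMeasure (Matrix.of fun u v => (A u v : ℝ≥0) / d) (fun _ => (Fintype.card V : ℝ≥0)⁻¹) μ

/-! #### Existence of the uniform Markov measure of a regular transition matrix -/

section Existence

variable {V : Type*} {A : Matrix V V ℕ} {d : ℕ}

/-- Run through labelled successors, starting at `e`. -/
def sftFwd (s : ∀ e, Fin d ≃ {f // A e f = 1}) (e : V) (ω : ℕ → Fin d × Fin d) : ℕ → V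
  | 0 => e
  | n + 1 => (s (sftFwd s e ω n) (ω n).1).1

/-- Run through labelled predecessors, starting at `e`. -/
def sftBwd (p : ∀ e, Fin d ≃ {f // A f e = 1}) (e : V) (ω : ℕ → Fin d × Fin d) : ℕ → V
  | 0 => e
  | n + 1 => (p (sftBwd p e ω n) (ω n).2).1

/-- The point of `X_A` with given coordinate at `0` and given labels. -/
def sftCode (s : ∀ e, Fin d ≃ {f // A e f = 1}) (p : ∀ e, Fin d ≃ {f // A f e = 1})
    (q : V × (ℕ → Fin d × Fin d)) : sftSet A :=
  ⟨fun i => match i with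
    | Int.ofNat n => sftFwd s q.1 q.2 n
    | Int.negSucc n => sftBwd p q.1 q.2 (n + 1), by
    intro i
    match i with
    | Int.ofNat n => exact (s (sftFwd s q.1 q.2 n) (q.2 n).1).2
    | Int.negSucc 0 => exact (p (sftBwd p q.1 q.2 0) (q.2 0).2).2
    | Int.negSucc (n + 1) => exact (p (sftBwd p q.1 q.2 (n + 1)) (q.2 (n + 1)).2).2⟩

theorem sftCode_ofNat (s : ∀ e, Fin d ≃ {f // A e f = 1}) (p : ∀ e, Fin d ≃ {f // A f e = 1})
    (q : V × (ℕ → Fin d × Fin d)) (n : ℕ) : (sftCode s p q).1 (n : ℤ) = sftFwd s q.1 q.2 n := rfl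

theorem sftCode_neg (s : ∀ e, Fin d ≃ {f // A e f = 1}) (p : ∀ e, Fin d ≃ {f // A f e = 1})
    (q : V × (ℕ → Fin d × Fin d)) (n : ℕ) :
    (sftCode s p q).1 (-(n : ℤ)) = sftBwd p q.1 q.2 n := by
  cases n <;> rfl

theorem measurable_sftCode [Finite V] [MeasurableSpace V] [MeasurableSingletonClass V]
    (s : ∀ e, Fin d ≃ {f // A e f = 1}) (p : ∀ e, Fin d ≃ {f // A f e = 1}) :
    Measurable (sftCode s p) := by
  have hf : ∀ n, Measurable fun q : V × (ℕ → Fin d × Fin d) => sftFwd s q.1 q.2 n := by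
    intro n
    induction n with
    | zero => exact measurable_fst
    | succ n ih =>
      have h : Measurable fun z : V × (Fin d × Fin d) => (s z.1 z.2.1).1 := measurable_of_countable _
      exact h.comp (ih.prodMk ((measurable_pi_apply n).comp measurable_snd))
  have hb : ∀ n, Measurable fun q : V × (ℕ → Fin d × Fin d) => sftBwd p q.1 q.2 n := by
    intro n
    induction n with
    | zero => exact measurable_fst
    | succ n ih =>
      have h : Measurable fun z : V × (Fin d × Fin d) => (p z.1 z.2.2).1 := measurable_of_countable _
      exact h.comp (ih.prodMk ((measurable_pi_apply n).comp measurable_snd))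
  refine Measurable.subtype_mk (measurable_pi_lambda _ fun i => ?_)
  match i with
  | Int.ofNat n => exact hf n
  | Int.negSucc n => exact hb (n + 1)

theorem measurableSet_sftCylinder [MeasurableSpace V] [MeasurableSingletonClass V]
    (a : ℤ) (k : ℕ) (w : ℕ → V) : MeasurableSet (sftCylinder A a k w) := by
  have : sftCylinder A a k w = ⋂ i : ℕ, ⋂ _ : i ≤ k, {x : sftSet A | x.1 (a + i) = w i} := by
    ext x; simp [sftCylinder]
  rw [this]
  refine MeasurableSet.iInter fun i => MeasurableSet.iInter fun _ => ?_
  have hm : Measurable fun x : sftSet A => x.1 (a + i) :=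
    (measurable_pi_apply (a + i : ℤ)).comp measurable_subtype_coe
  exact hm (measurableSet_singleton (w i))

/-- The value that the uniform Markov measure gives to a cylinder. -/
noncomputable def sftWeight [Fintype V] (A : Matrix V V ℕ) (d : ℕ) (k : ℕ) (w : ℕ → V) : ℝ≥0 :=
  (Fintype.card V : ℝ≥0)⁻¹ * ∏ i ∈ Finset.range k, (A (w i) (w (i + 1)) : ℝ≥0) / d

theorem sft_right_step [Fintype V] [MeasurableSpace V] [MeasurableSingletonClass V]
    (hA : IsRegularTransition A d) (hd : 0 < d) (μ : Measure (sftSet A)) (a : ℤ) (k : ℕ)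
    (h : ∀ w, μ (sftCylinder A a (k + 1) w) = (sftWeight A d (k + 1) w : ℝ≥0∞)) (w : ℕ → V) :
    μ (sftCylinder A a k w) = (sftWeight A d k w : ℝ≥0∞) := by
  set w' : V → ℕ → V := fun b i => if i ≤ k then w i else b with hw'
  have hU : sftCylinder A a k w = ⋃ b : V, sftCylinder A a (k + 1) (w' b) := by
    ext x
    simp only [sftCylinder, Set.mem_ofPred_eq, Set.mem_iUnion, hw']
    constructor
    · intro hx
      refine ⟨x.1 (a + (k + 1 : ℕ)), fun i hi => ?_⟩
      split_ifs with h1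
      · exact hx i h1
      · obtain rfl : i = k + 1 := by omega
        rfl
    · rintro ⟨b, hb⟩ i hi
      have := hb i (by omega)
      rwa [if_pos hi] at this
  have hdis : Pairwise (Function.onFun Disjoint fun b : V => sftCylinder A a (k + 1) (w' b)) := by
    intro b c hbc
    refine Set.disjoint_left.2 fun x hx hy => hbc ?_
    have h1 := hx (k + 1) le_rfl
    have h2 := hy (k + 1) le_rfl
    simp only [hw', Nat.not_succ_le_self, if_false] at h1 h2
    exact h1.symm.trans h2
  rw [hU, measure_iUnion hdis fun b => measurableSet_sftCylinder _ _ _, tsum_fintype]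
  simp only [h]
  rw [← ENNReal.ofNNReal_finsetSum]
  congr 1
  have : ∀ b, sftWeight A d (k + 1) (w' b) = sftWeight A d k w * ((A (w k) b : ℝ≥0) / d) := by
    intro b
    simp only [sftWeight, Finset.prod_range_succ, ← mul_assoc]
    congr 1
    · congr 1
      refine Finset.prod_congr rfl fun i hi => ?_
      have := Finset.mem_range.1 hi
      simp [hw', show i ≤ k by omega, show i + 1 ≤ k by omega]
    · simp [hw']
  simp only [this]
  rw [← Finset.mul_sum, ← Finset.sum_div, ← Nat.cast_sum, hA.row_sum, div_self, mul_one]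
  exact_mod_cast hd.ne'

theorem sft_left_step [Fintype V] [MeasurableSpace V] [MeasurableSingletonClass V]
    (hA : IsRegularTransition A d) (hd : 0 < d) (μ : Measure (sftSet A)) (a : ℤ) (k : ℕ)
    (h : ∀ w, μ (sftCylinder A a (k + 1) w) = (sftWeight A d (k + 1) w : ℝ≥0∞)) (w : ℕ → V) :
    μ (sftCylinder A (a + 1) k w) = (sftWeight A d k w : ℝ≥0∞) := by
  set w' : V → ℕ → V := fun b i => Nat.casesOn i b w with hw'
  have hU : sftCylinder A (a + 1) k w = ⋃ b : V, sftCylinder A a (k + 1) (w' b) := by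
    ext x
    simp only [sftCylinder, Set.mem_ofPred_eq, Set.mem_iUnion]
    constructor
    · intro hx
      refine ⟨x.1 a, fun i hi => ?_⟩
      cases i with
      | zero => simp [hw']
      | succ i =>
        have := hx i (by omega)
        rw [show a + ((i + 1 : ℕ) : ℤ) = a + 1 + i by push_cast; ring]
        exact this
    · rintro ⟨b, hb⟩ i hi
      have := hb (i + 1) (by omega)
      rw [show a + ((i + 1 : ℕ) : ℤ) = a + 1 + i by push_cast; ring] at this
      exact this
  have hdis : Pairwise (Function.onFun Disjoint fun b : V => sftCylinder A a (k + 1) (w' b)) := by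
    intro b c hbc
    refine Set.disjoint_left.2 fun x hx hy => hbc ?_
    exact (hx 0 (by omega)).symm.trans (hy 0 (by omega))
  rw [hU, measure_iUnion hdis fun b => measurableSet_sftCylinder _ _ _, tsum_fintype]
  simp only [h]
  rw [← ENNReal.ofNNReal_finsetSum]
  congr 1
  have : ∀ b, sftWeight A d (k + 1) (w' b) = sftWeight A d k w * ((A b (w 0) : ℝ≥0) / d) := by
    intro b
    simp only [sftWeight, Finset.prod_range_succ', ← mul_assoc]
    rfl
  simp only [this]
  rw [← Finset.mul_sum, ← Finset.sum_div, ← Nat.cast_sum, hA.col_sum, div_self, mul_one]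
  exact_mod_cast hd.ne'

theorem exists_isUniformMarkovMeasure [Fintype V] [Nonempty V] [MeasurableSpace V]
    [MeasurableSingletonClass V] (hA : IsRegularTransition A d) (hd : 0 < d) :
    ∃ μ : Measure (sftSet A), IsUniformMarkovMeasure A d μ := by
  classical
  have : Nonempty (Fin d) := ⟨⟨0, hd⟩⟩
  have hval : ∀ u v, A u v = if A u v = 1 then 1 else 0 := by
    intro u v
    rcases hA.zero_or_one u v with h | h <;> simp [h]
  have hs : ∀ e, Fintype.card {f // A e f = 1} = d := by
    intro e
    rw [Fintype.card_subtype, ← hA.row_sum e, Finset.card_filter]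
    exact Finset.sum_congr rfl fun v _ => (hval e v).symm
  have hp : ∀ e, Fintype.card {f // A f e = 1} = d := by
    intro e
    rw [Fintype.card_subtype, ← hA.col_sum e, Finset.card_filter]
    exact Finset.sum_congr rfl fun v _ => (hval v e).symm
  let s : ∀ e, Fin d ≃ {f // A e f = 1} := fun e => (Fintype.equivFinOfCardEq (hs e)).symm
  let p : ∀ e, Fin d ≃ {f // A f e = 1} := fun e => (Fintype.equivFinOfCardEq (hp e)).symm
  let ν₀ : Measure V := (PMF.uniformOfFintype V).toMeasure
  let ν₁ : Measure (Fin d × Fin d) := (PMF.uniformOfFintype (Fin d × Fin d)).toMeasure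
  let ν : Measure (V × (ℕ → Fin d × Fin d)) := ν₀.prod (Measure.infinitePi fun _ => ν₁)
  have hν₀ : ∀ e, ν₀ {e} = (((Fintype.card V : ℝ≥0)⁻¹ : ℝ≥0) : ℝ≥0∞) := by
    intro e
    rw [PMF.toMeasure_apply_singleton _ _ (measurableSet_singleton e),
      PMF.uniformOfFintype_apply, ENNReal.coe_inv (by exact_mod_cast Fintype.card_ne_zero)]
    simp
  have hν₁ : ∀ c, ν₁ {c} = (((d : ℝ≥0)⁻¹ * (d : ℝ≥0)⁻¹ : ℝ≥0) : ℝ≥0∞) := by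
    intro c
    rw [PMF.toMeasure_apply_singleton _ _ (measurableSet_singleton c),
      PMF.uniformOfFintype_apply, ← mul_inv, ENNReal.coe_inv (by positivity)]
    simp
  -- the mass of a symmetric window
  have hwin : ∀ (K : ℕ) (y z : ℕ → V), y 0 = z 0 →
      ν {q | ∀ n ≤ K, sftFwd s q.1 q.2 n = y n ∧ sftBwd p q.1 q.2 n = z n} =
        (((Fintype.card V : ℝ≥0)⁻¹ * ∏ n ∈ Finset.range K,
          (((A (y n) (y (n + 1)) : ℝ≥0) / d) * ((A (z (n + 1)) (z n) : ℝ≥0) / d)) : ℝ≥0) : ℝ≥0∞) := by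
    intro K y z hyz
    by_cases hadm : ∀ n < K, A (y n) (y (n + 1)) = 1 ∧ A (z (n + 1)) (z n) = 1
    · let c : ℕ → Fin d × Fin d := fun n =>
        if h : A (y n) (y (n + 1)) = 1 ∧ A (z (n + 1)) (z n) = 1 then
          ((s (y n)).symm ⟨_, h.1⟩, (p (z n)).symm ⟨_, h.2⟩) else Classical.arbitrary _
      have hset : {q : V × (ℕ → Fin d × Fin d) |
            ∀ n ≤ K, sftFwd s q.1 q.2 n = y n ∧ sftBwd p q.1 q.2 n = z n} =
          {y 0} ×ˢ Set.pi (Finset.range K : Set ℕ) (fun n => {c n}) := by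
        ext ⟨e, ω⟩
        simp only [Set.mem_ofPred_eq, Set.mem_prod, Set.mem_singleton_iff, Set.mem_pi,
          Finset.coe_range, Set.mem_Iio]
        constructor
        · intro h
          refine ⟨(h 0 (Nat.zero_le _)).1, fun n hn => ?_⟩
          have h0 := h n hn.le
          have h1 := h (n + 1) hn
          simp only [c, dif_pos (hadm n hn)]
          refine Prod.ext ?_ ?_
          · rw [Equiv.eq_symm_apply]
            refine Subtype.ext ?_
            have := h1.1
            simp only [sftFwd] at this
            rw [h0.1] at this
            exact this
          · rw [Equiv.eq_symm_apply]
            refine Subtype.ext ?_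
            have := h1.2
            simp only [sftBwd] at this
            rw [h0.2] at this
            exact this
        · rintro ⟨he, hω⟩ n
          induction n with
          | zero => exact fun _ => ⟨he, he.trans hyz⟩
          | succ n ih =>
            intro hn
            obtain ⟨h1, h2⟩ := ih (by omega)
            have h3 := hω n (by omega)
            simp only [c, dif_pos (hadm n (by omega))] at h3
            have key1 : ∀ (u : V) (hu : u = y n),
                (s u ((s (y n)).symm ⟨_, (hadm n (by omega)).1⟩)).1 = y (n + 1) := by
              rintro u rfl; simp
            have key2 : ∀ (u : V) (hu : u = z n),
                (p u ((p (z n)).symm ⟨_, (hadm n (by omega)).2⟩)).1 = z (n + 1) := by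
              rintro u rfl; simp
            simp only [sftFwd, sftBwd, h3]
            exact ⟨key1 _ h1, key2 _ h2⟩
      rw [hset, Measure.prod_prod, Measure.infinitePi_pi _ fun n _ => measurableSet_singleton _,
        hν₀]
      simp only [hν₁]
      rw [← ENNReal.ofNNReal_finsetProd, ← ENNReal.coe_mul]
      congr 2
      refine Finset.prod_congr rfl fun n hn => ?_
      have := hadm n (Finset.mem_range.1 hn)
      simp [this.1, this.2]
    · have hset : {q : V × (ℕ → Fin d × Fin d) |
            ∀ n ≤ K, sftFwd s q.1 q.2 n = y n ∧ sftBwd p q.1 q.2 n = z n} = ∅ := by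
        refine Set.eq_empty_of_forall_notMem fun q hq => hadm fun n hn => ?_
        have h0 := hq n hn.le
        have h1 := hq (n + 1) hn
        rw [← h0.1, ← h0.2, ← h1.1, ← h1.2]
        exact ⟨(s _ _).2, (p _ _).2⟩
      rw [hset, measure_empty]
      push Not at hadm
      obtain ⟨n, hn, h⟩ := hadm
      rw [Finset.prod_eq_zero (Finset.mem_range.2 hn)]
      · simp
      · rcases hA.zero_or_one (y n) (y (n + 1)) with h1 | h1
        · simp [h1]
        · rcases hA.zero_or_one (z (n + 1)) (z n) with h2 | h2
          · simp [h2]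
          · exact absurd h2 (h h1)
  have hΦ := measurable_sftCode s p
  let μ : Measure (sftSet A) := ν.map (sftCode s p)
  have hsym : ∀ (K : ℕ) (w : ℕ → V),
      μ (sftCylinder A (-(K : ℤ)) (K + K) w) = (sftWeight A d (K + K) w : ℝ≥0∞) := by
    intro K w
    have hpre : sftCode s p ⁻¹' sftCylinder A (-(K : ℤ)) (K + K) w =
        {q | ∀ n ≤ K, sftFwd s q.1 q.2 n = w (K + n) ∧ sftBwd p q.1 q.2 n = w (K - n)} := by
      ext q
      simp only [sftCylinder, Set.mem_preimage, Set.mem_ofPred_eq]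
      constructor
      · intro h n hn
        constructor
        · have := h (K + n) (by omega)
          rwa [show -(K : ℤ) + ((K + n : ℕ) : ℤ) = (n : ℤ) by push_cast; ring,
            sftCode_ofNat] at this
        · have := h (K - n) (by omega)
          rwa [show -(K : ℤ) + ((K - n : ℕ) : ℤ) = -(n : ℤ) by omega, sftCode_neg] at this
      · intro h i hi
        rcases le_total K i with hK | hK
        · have := (h (i - K) (by omega)).1
          rw [show -(K : ℤ) + (i : ℤ) = ((i - K : ℕ) : ℤ) by omega, sftCode_ofNat, this]
          congr 1; omega
        · have := (h (K - i) (by omega)).2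
          rw [show -(K : ℤ) + (i : ℤ) = -((K - i : ℕ) : ℤ) by omega, sftCode_neg, this]
          congr 1; omega
    rw [Measure.map_apply hΦ (measurableSet_sftCylinder _ _ _), hpre,
      hwin K (fun n => w (K + n)) (fun n => w (K - n)) rfl]
    congr 1
    rw [sftWeight, Finset.prod_mul_distrib, Finset.prod_range_add,
      ← Finset.prod_range_reflect (fun i => (A (w i) (w (i + 1)) : ℝ≥0) / d) K,
      mul_comm (∏ n ∈ Finset.range K, _) (∏ n ∈ Finset.range K, _)]
    congr 2
    refine Finset.prod_congr rfl fun n hn => ?_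
    have := Finset.mem_range.1 hn
    rw [show K - (n + 1) = K - 1 - n by omega, show K - n = K - 1 - n + 1 by omega]
  refine ⟨μ, ?_⟩
  have hR : ∀ (m : ℕ) (a : ℤ) (k : ℕ),
      (∀ w, μ (sftCylinder A a (k + m) w) = (sftWeight A d (k + m) w : ℝ≥0∞)) →
      ∀ w, μ (sftCylinder A a k w) = (sftWeight A d k w : ℝ≥0∞) := by
    intro m
    induction m with
    | zero => exact fun a k h => h
    | succ m ih => exact fun a k h => ih a k (sft_right_step hA hd μ a (k + m) h)
  have hL : ∀ (m : ℕ) (a : ℤ) (k : ℕ),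
      (∀ w, μ (sftCylinder A a (k + m) w) = (sftWeight A d (k + m) w : ℝ≥0∞)) →
      ∀ w, μ (sftCylinder A (a + m) k w) = (sftWeight A d k w : ℝ≥0∞) := by
    intro m
    induction m with
    | zero => intro a k h; simpa using h
    | succ m ih =>
      intro a k h
      have := ih (a + 1) k (sft_left_step hA hd μ a (k + m) h)
      rwa [show a + 1 + (m : ℤ) = a + ((m + 1 : ℕ) : ℤ) by push_cast; ring] at this
  intro a k w
  have key : ∀ w, μ (sftCylinder A a k w) = (sftWeight A d k w : ℝ≥0∞) := by
    set K := a.natAbs + k with hK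
    obtain ⟨m, hm⟩ : ∃ m : ℕ, a = -(K : ℤ) + m := ⟨(a + K).toNat, by omega⟩
    have h1 := hL m (-(K : ℤ)) (K + K - m) (by
      rw [show K + K - m + m = K + K by omega]; exact hsym K)
    rw [← hm] at h1
    refine hR (K + K - m - k) a k ?_
    rw [show k + (K + K - m - k) = K + K - m by omega]
    exact h1
  exact key w

end Existence

open Classical in
/-- The natural measure on the subshift `X_A` of a `d`-regular transition matrix `A`: the Markov
measure of `d⁻¹ A` with the uniform stationary distribution. It exists whenever `A` is `d`-regular,
`0 < d` and the alphabet is nonempty, as proved above, and it is determined by its values on the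
cylinders, which form a generating `π`-system. -/
noncomputable def uniformMarkovMeasure {V : Type*} [Fintype V] [MeasurableSpace V]
    (A : Matrix V V ℕ) (d : ℕ) : Measure (sftSet A) :=
  if h : ∃ μ : Measure (sftSet A), IsUniformMarkovMeasure A d μ then h.choose else 0

theorem isUniformMarkovMeasure_uniformMarkovMeasure {V : Type*} [Fintype V] [Nonempty V]
    [MeasurableSpace V] [MeasurableSingletonClass V] {A : Matrix V V ℕ} {d : ℕ}
    (hA : IsRegularTransition A d) (hd : 0 < d) :
    IsUniformMarkovMeasure A d (uniformMarkovMeasure A d) := by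
  have h := exists_isUniformMarkovMeasure hA hd
  rw [uniformMarkovMeasure, dif_pos h]
  exact h.choose_spec

end Subshift

/-! ### Strong mixing and decay of correlations -/

/-- Strong mixing of `(X, T, μ)`, tested on all square integrable functions. -/
def StronglyMixing {X : Type*} [MeasurableSpace X] (T : X → X) (μ : Measure X) : Prop :=
  ∀ f g : X → ℂ, MemLp f 2 μ → MemLp g 2 μ →
    Tendsto (fun n : ℕ => ∫ x, f (T^[n] x) * g x ∂μ) atTop
      (𝓝 ((∫ x, f x ∂μ) * ∫ x, g x ∂μ))

/-! ### Multigraphs -/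

namespace Graph

variable {α β : Type*}

/-- The degree of a vertex; a loop contributes two. -/
noncomputable def degree (G : Graph α β) (v : α) : ℕ :=
  {e | G.IsNonloopAt e v}.ncard + 2 * {e | G.IsLoopAt e v}.ncard

/-- Every vertex has degree `k`. -/
def IsRegularOfDegree (G : Graph α β) (k : ℕ) : Prop := ∀ v ∈ V(G), G.degree v = k

open Classical in
/-- The adjacency matrix: off the diagonal the number of edges between two vertices, on the diagonal
twice the number of loops. -/
noncomputable def adjMatrix (G : Graph α β) : Matrix V(G) V(G) ℝ :=
  Matrix.of fun u v =>
    if u = v then 2 * ({e | G.IsLoopAt e (u : α)}.ncard : ℝ)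
    else ({e | G.IsLink e (u : α) (v : α)}.ncard : ℝ)

/-- There is a vertex, and any two vertices are joined by a walk. -/
def Connected (G : Graph α β) : Prop :=
  V(G).Nonempty ∧ ∀ u ∈ V(G), ∀ v ∈ V(G), Relation.ReflTransGen G.Adj u v

/-- The vertices have a two-colouring in which the ends of every edge get different colours (so there
are no loops). -/
def IsBipartite (G : Graph α β) : Prop :=
  ∃ c : α → Bool, ∀ e x y, G.IsLink e x y → c x ≠ c y

/-- A `(d + 1)`-regular Ramanujan graph. -/
structure IsRamanujan (G : Graph α β) [Fintype V(G)] (d : ℕ) : Prop where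
  connected : G.Connected
  regular : G.IsRegularOfDegree (d + 1)
  eigenvalue : ∀ lam : ℝ, Module.End.HasEigenvalue G.adjMatrix.mulVecLin lam →
    lam = d + 1 ∨ lam = -(d + 1) ∨ |lam| ≤ 2 * √(d : ℝ)

/-- An oriented edge of `G`: an edge with one of its two orientations. Every edge, a loop included,
gives exactly two oriented edges. -/
@[ext]
structure OrientedEdge (G : Graph α β) where
  edge : E(G)
  dir : Bool

/-- The ends of an edge, in some arbitrarily chosen order. -/
noncomputable def ends (G : Graph α β) (e : E(G)) : α × α :=
  ((G.exists_isLink_of_mem_edgeSet e.2).choose,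
    (G.exists_isLink_of_mem_edgeSet e.2).choose_spec.choose)

theorem isLink_ends (G : Graph α β) (e : E(G)) : G.IsLink e (G.ends e).1 (G.ends e).2 :=
  (G.exists_isLink_of_mem_edgeSet e.2).choose_spec.choose_spec

namespace OrientedEdge

variable {G : Graph α β}

instance : TopologicalSpace G.OrientedEdge := ⊥

instance : DiscreteTopology G.OrientedEdge := ⟨rfl⟩

instance : MeasurableSpace G.OrientedEdge := ⊤

instance : DiscreteMeasurableSpace G.OrientedEdge := ⟨fun _ => trivial⟩

/-- Oriented edges are pairs of an edge and a direction. -/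
def equivProd : G.OrientedEdge ≃ E(G) × Bool where
  toFun a := (a.edge, a.dir)
  invFun p := ⟨p.1, p.2⟩
  left_inv _ := rfl
  right_inv _ := rfl

instance [Fintype E(G)] : Fintype G.OrientedEdge := Fintype.ofEquiv _ equivProd.symm

/-- The origin of an oriented edge. -/
noncomputable def origin (a : G.OrientedEdge) : α :=
  if a.dir then (G.ends a.edge).1 else (G.ends a.edge).2

/-- The inverse oriented edge. -/
def inv (a : G.OrientedEdge) : G.OrientedEdge := ⟨a.edge, !a.dir⟩

/-- The terminal vertex of an oriented edge. -/
noncomputable def terminus (a : G.OrientedEdge) : α :=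
  if a.dir then (G.ends a.edge).2 else (G.ends a.edge).1

end OrientedEdge

open Classical in
/-- The non-backtracking (Bass-Hashimoto) matrix. -/
noncomputable def nonBacktrackingMatrix (G : Graph α β) :
    Matrix G.OrientedEdge G.OrientedEdge ℕ :=
  Matrix.of fun e f => if e.terminus = f.origin ∧ f ≠ e.inv then 1 else 0

/-- The non-backtracking edge subshift `E_G`. -/
abbrev edgeSubshift (G : Graph α β) : Set (ℤ → G.OrientedEdge) := sftSet G.nonBacktrackingMatrix

theorem mem_edgeSubshift (G : Graph α β) (x : ℤ → G.OrientedEdge) :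
    x ∈ G.edgeSubshift ↔
      ∀ n : ℤ, (x n).terminus = (x (n + 1)).origin ∧ x (n + 1) ≠ (x n).inv := by
  simp [edgeSubshift, sftSet, nonBacktrackingMatrix]

/-- The shift map on `E_G`. -/
noncomputable def edgeShift (G : Graph α β) : G.edgeSubshift → G.edgeSubshift :=
  sftShift G.nonBacktrackingMatrix

/-- The natural measure on the non-backtracking edge subshift of a `(d + 1)`-regular graph. -/
noncomputable def edgeMeasure (G : Graph α β) [Fintype E(G)] (d : ℕ) : Measure G.edgeSubshift :=
  uniformMarkovMeasure G.nonBacktrackingMatrix d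

/-! #### The non-backtracking matrix of a `(d + 1)`-regular graph is `d`-regular -/

open Classical in
theorem card_origin_eq (G : Graph α β) [Fintype E(G)] (v : α) :
    (Finset.univ.filter fun a : G.OrientedEdge => a.origin = v).card = G.degree v := by
  have h1 : {e | G.IsNonloopAt e v}.ncard =
      ∑ e : E(G), if G.IsNonloopAt (e : β) v then 1 else 0 := by
    rw [← Finset.card_filter, ← Set.ncard_coe_finset,
      ← Set.ncard_image_of_injective _ (Subtype.val_injective (p := fun e => e ∈ E(G)))]
    congr 1
    ext e
    simp only [Set.mem_ofPred_eq, Finset.coe_filter, Finset.mem_univ, true_and, Set.mem_image,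
      Subtype.exists, exists_and_left, exists_prop, exists_eq_right_right]
    constructor
    · intro h
      refine ⟨h, ?_⟩
      obtain ⟨y, _, hy⟩ := h
      exact hy.edge_mem
    · exact fun h => h.1
  have h2 : {e | G.IsLoopAt e v}.ncard =
      ∑ e : E(G), if G.IsLoopAt (e : β) v then 1 else 0 := by
    rw [← Finset.card_filter, ← Set.ncard_coe_finset,
      ← Set.ncard_image_of_injective _ (Subtype.val_injective (p := fun e => e ∈ E(G)))]
    congr 1
    ext e
    simp only [Set.mem_ofPred_eq, Finset.coe_filter, Finset.mem_univ, true_and, Set.mem_image,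
      Subtype.exists, exists_and_left, exists_prop, exists_eq_right_right]
    exact ⟨fun h => ⟨h, IsLink.edge_mem h⟩, fun h => h.1⟩
  rw [degree, h1, h2, Finset.mul_sum, ← Finset.sum_add_distrib, Finset.card_filter,
    ← OrientedEdge.equivProd.symm.sum_comp, Fintype.sum_prod_type]
  refine Finset.sum_congr rfl fun e _ => ?_
  have hl := G.isLink_ends e
  simp only [Fintype.sum_bool, OrientedEdge.equivProd, Equiv.coe_fn_symm_mk, OrientedEdge.origin,
    if_true, Bool.false_eq_true, if_false, IsNonloopAt, IsLoopAt, hl.isLink_iff]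
  generalize (G.ends e).1 = a
  generalize (G.ends e).2 = b
  by_cases ha : a = v <;> by_cases hb : b = v
  · subst ha; subst hb; simp
  · subst ha; simp [hb]
  · subst hb
    simp [ha]
  · simp [ha, hb]

theorem isRegularTransition_nonBacktrackingMatrix (G : Graph α β) [Fintype E(G)] {d : ℕ}
    (hG : G.IsRegularOfDegree (d + 1)) : IsRegularTransition G.nonBacktrackingMatrix d := by
  classical
  have hinv : ∀ a : G.OrientedEdge, a.inv.inv = a := fun a => by
    cases a; simp [OrientedEdge.inv]
  have hoi : ∀ a : G.OrientedEdge, a.inv.origin = a.terminus := fun a => by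
    rcases a with ⟨e, b⟩; cases b <;> simp [OrientedEdge.inv, OrientedEdge.origin,
      OrientedEdge.terminus]
  have hV : ∀ a : G.OrientedEdge, a.origin ∈ V(G) := fun a => by
    rcases a with ⟨e, b⟩
    cases b
    · simpa [OrientedEdge.origin] using (G.isLink_ends e).right_mem
    · simpa [OrientedEdge.origin] using (G.isLink_ends e).left_mem
  have key : ∀ a : G.OrientedEdge,
      (Finset.univ.filter fun f : G.OrientedEdge => a.origin = f.origin ∧ f ≠ a).card = d := by
    intro a
    have : (Finset.univ.filter fun f : G.OrientedEdge => a.origin = f.origin ∧ f ≠ a) =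
        (Finset.univ.filter fun f : G.OrientedEdge => f.origin = a.origin).erase a := by
      ext f; simp [eq_comm, and_comm]
    rw [this, Finset.card_erase_of_mem (by simp), card_origin_eq, hG _ (hV a)]
    rfl
  refine ⟨fun e f => ?_, fun e => ?_, fun f => ?_⟩
  · simp only [nonBacktrackingMatrix, Matrix.of_apply]
    split_ifs <;> simp
  · simp only [nonBacktrackingMatrix, Matrix.of_apply]
    rw [← Finset.card_filter, ← key e.inv, hoi]
  · simp only [nonBacktrackingMatrix, Matrix.of_apply]
    let φ : G.OrientedEdge ≃ G.OrientedEdge := ⟨OrientedEdge.inv, OrientedEdge.inv, hinv, hinv⟩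
    rw [← φ.sum_comp, ← key f, Finset.card_filter]
    refine Finset.sum_congr rfl fun e _ => ?_
    have h1 : (φ e).terminus = e.origin := by
      change e.inv.terminus = e.origin
      rw [← hoi, hinv]
    have h2 : (φ e).inv = e := hinv e
    rw [h1, h2]
    refine if_congr ?_ rfl rfl
    rw [eq_comm, ne_comm]

/-- The measure on `E_G` gives mass `1 / (N d ^ k)` to every cylinder of an admissible word with
`k + 1` letters, where `N` is the number of oriented edges, and mass `0` to the other cylinders. -/
theorem isUniformMarkovMeasure_edgeMeasure (G : Graph α β) [Fintype E(G)] {d : ℕ} (hd : 0 < d)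
    (hV : V(G).Nonempty) (hG : G.IsRegularOfDegree (d + 1)) :
    IsUniformMarkovMeasure G.nonBacktrackingMatrix d (G.edgeMeasure d) := by
  classical
  obtain ⟨v, hv⟩ := hV
  have h := G.card_origin_eq v
  rw [hG v hv] at h
  obtain ⟨a, _⟩ := Finset.card_pos.1 (lt_of_lt_of_eq (Nat.succ_pos d) h.symm)
  have : Nonempty G.OrientedEdge := ⟨a⟩
  exact isUniformMarkovMeasure_uniformMarkovMeasure
    (G.isRegularTransition_nonBacktrackingMatrix hG) hd

end Graph

/-! Write `H` for the non-backtracking matrix and `N` for the number of oriented edges. Both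
statements are equivalent to a third, purely linear one: every entry of `(H / d) ^ n` differs from
`1 / N` by `O((n + 1) / √d ^ n)`. In terms of functions on oriented edges this says
`G.decaySubmodule d = ⊤`.

Dynamics (`decaySubmodule_eq_top_iff_exists`, `IsMarkovMeasure.measure_inter`). The correlation of
two one-letter cylinders is `1 / N` times an entry of `(H / d) ^ n` minus `1 / N`, so the rate of
decay gives the matrix estimate. Strong mixing is not needed for this direction. Conversely, by the
Markov property the matrix estimate controls all pairs of cylinders. Bilinearity extends it to
locally constant functions, and their density in `L²` yields strong mixing.

Spectrum (`decaySubmodule_eq_top_iff`). If `φ` is an eigenfunction of the adjacency matrix with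
eigenvalue `λ`, then `H (φ ∘ src) = d (φ ∘ tgt)` and `H (φ ∘ tgt) = λ (φ ∘ tgt) - φ ∘ src`, an
action with characteristic polynomial `θ ^ 2 - λ θ + d`. On the orthogonal complement of all
functions `φ ∘ src` and `φ ∘ tgt`, `H` is minus the inversion of edges, so its powers stay bounded
there. If `|λ| ≤ 2 √d`, both roots have modulus `√d`; a double root accounts for the factor `n`. If
`|λ| > 2 √d`, one root is real of modulus above `√d`, and decay fails unless this root is `d`, that
is, `λ = d + 1`. The eigenvalue `d + 1` belongs to constants only exactly when `G` is connected, and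
a connected `G` has the eigenvalue `-(d + 1)` exactly when it is bipartite. -/

/-! ### A two-term linear recurrence -/

/-- The quadratic form `v (n + 1) ^ 2 - 2 c v (n + 1) v n + v n ^ 2` is constant along the
recurrence `v (n + 2) = 2 c v (n + 1) - v n`. -/
theorem abs_le_linear_of_recurrence {v : ℕ → ℝ} {c : ℝ} (hc : |c| ≤ 1)
    (hv : ∀ n, v (n + 2) = 2 * c * v (n + 1) - v n) :
    ∃ C : ℝ, 0 ≤ C ∧ ∀ n, |v n| ≤ |v 0| + C * n := by
  set E : ℝ := v 1 ^ 2 - 2 * c * v 1 * v 0 + v 0 ^ 2 with hE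
  have hcons : ∀ n, v (n + 1) ^ 2 - 2 * c * v (n + 1) * v n + v n ^ 2 = E := by
    intro n
    induction n with
    | zero => rfl
    | succ n ih =>
      rw [hv n, ← ih]
      ring
  have hc2 : 0 ≤ 1 - c ^ 2 := by
    have := (sq_le_one_iff_abs_le_one c).2 hc
    linarith
  refine ⟨√E, Real.sqrt_nonneg _, fun n => ?_⟩
  induction n with
  | zero => simp
  | succ n ih =>
    -- Completing the square, `E = (v (n + 1) - c v n) ^ 2 + (1 - c ^ 2) v n ^ 2`, and the last term
    -- is nonnegative. So each step adds at most `√E` to `|v n|`, also in the double root case `|c|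
    -- = 1`.
    have h1 : |v (n + 1) - c * v n| ≤ √E := by
      refine Real.abs_le_sqrt ?_
      have := mul_nonneg hc2 (sq_nonneg (v n))
      rw [← hcons n]
      nlinarith
    have h2 : |c * v n| ≤ |v n| := by
      rw [abs_mul]
      exact mul_le_of_le_one_left (abs_nonneg _) hc
    have h3 : |v (n + 1)| ≤ |v (n + 1) - c * v n| + |c * v n| := by
      simpa using abs_add_le (v (n + 1) - c * v n) (c * v n)
    push_cast
    linarith

/-- Dividing `u n` by `√d ^ n` turns the recurrence into the normalised one with `c = lam / (2 √d)`,
and the hypothesis on `lam` is precisely `|c| ≤ 1`. No distinction between complex and double roots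
is needed. -/
theorem abs_le_of_recurrence {u : ℕ → ℝ} {lam d : ℝ} (hd : 0 < d) (hlam : |lam| ≤ 2 * √d)
    (hu : ∀ n, u (n + 2) = lam * u (n + 1) - d * u n) :
    ∃ C : ℝ, 0 ≤ C ∧ ∀ n, |u n| ≤ C * (n + 1) * √d ^ n := by
  have hr : 0 < √d := Real.sqrt_pos.2 hd
  have hr2 : √d ^ 2 = d := Real.sq_sqrt hd.le
  obtain ⟨C, hC0, hC⟩ := abs_le_linear_of_recurrence (v := fun n => u n / √d ^ n)
    (c := lam / (2 * √d)) (by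
      rw [abs_div, abs_of_pos (by positivity : 0 < 2 * √d)]
      exact div_le_one_of_le₀ hlam (by positivity)) (fun n => by
      simp only [hu n]
      field_simp
      linear_combination u n * √d ^ (2 * n + 2) * hr2)
  refine ⟨C + |u 0|, by positivity, fun n => ?_⟩
  have h := hC n
  simp only [pow_zero, div_one, abs_div, abs_of_pos (pow_pos hr n)] at h
  rw [div_le_iff₀ (pow_pos hr n)] at h
  refine h.trans (mul_le_mul_of_nonneg_right ?_ (pow_pos hr n).le)
  nlinarith [abs_nonneg (u 0), mul_nonneg (abs_nonneg (u 0)) (Nat.cast_nonneg (α := ℝ) n)]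

/-! ### Oriented edges and their end vertices -/

namespace Graph

variable {α β : Type*} {G : Graph α β}

namespace OrientedEdge

theorem isLink (a : G.OrientedEdge) : G.IsLink a.edge a.origin a.terminus := by
  rcases a with ⟨e, b⟩
  cases b
  · simpa [origin, terminus] using (G.isLink_ends e).symm
  · simpa [origin, terminus] using G.isLink_ends e

@[simp] theorem inv_inv (a : G.OrientedEdge) : a.inv.inv = a := by
  cases a; simp [inv]

/-- The origin, as a vertex of `G`. -/
noncomputable def src (a : G.OrientedEdge) : V(G) := ⟨a.origin, a.isLink.left_mem⟩

/-- The terminal vertex, as a vertex of `G`. -/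
noncomputable def tgt (a : G.OrientedEdge) : V(G) := ⟨a.terminus, a.isLink.right_mem⟩

@[simp] theorem src_inv (a : G.OrientedEdge) : a.inv.src = a.tgt := by
  rcases a with ⟨e, b⟩
  cases b <;> simp [inv, src, tgt, origin, terminus]

@[simp] theorem tgt_inv (a : G.OrientedEdge) : a.inv.tgt = a.src := by
  rw [← src_inv, inv_inv]

/-- Inversion of oriented edges as an involution. -/
def invEquiv : G.OrientedEdge ≃ G.OrientedEdge := ⟨inv, inv, inv_inv, inv_inv⟩

@[simp] theorem invEquiv_apply (a : G.OrientedEdge) : invEquiv a = a.inv := rfl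

theorem exists_of_isLink {e : β} {x y : α} (h : G.IsLink e x y) :
    ∃ a : G.OrientedEdge, a.origin = x ∧ a.terminus = y := by
  rcases (G.isLink_ends ⟨e, h.edge_mem⟩).eq_and_eq_or_eq_and_eq h with ⟨h1, h2⟩ | ⟨h1, h2⟩
  · exact ⟨⟨⟨e, h.edge_mem⟩, true⟩, by simpa [origin] using h1, by simpa [terminus] using h2⟩
  · exact ⟨⟨⟨e, h.edge_mem⟩, false⟩, by simpa [origin] using h2, by simpa [terminus] using h1⟩

end OrientedEdge

open OrientedEdge

/-! ### Stars of oriented edges and the adjacency matrix -/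

section Counting

variable [Fintype E(G)]

open Classical in
theorem card_src_eq {k : ℕ} (hG : G.IsRegularOfDegree k) (v : V(G)) :
    (Finset.univ.filter fun a : G.OrientedEdge => a.src = v).card = k := by
  rw [← hG v v.2, ← G.card_origin_eq]
  congr 1
  ext a
  simp [src, Subtype.ext_iff]

theorem exists_src_eq {k : ℕ} (hG : G.IsRegularOfDegree (k + 1)) (v : V(G)) :
    ∃ a : G.OrientedEdge, a.src = v := by
  classical
  have h := card_src_eq hG v
  obtain ⟨a, ha⟩ := Finset.card_pos.1 (lt_of_lt_of_eq (Nat.succ_pos k) h.symm)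
  exact ⟨a, by simpa using ha⟩

open Classical in
-- A loop has two orientations, both from `u` to `u`, which matches the factor two on the diagonal;
-- an edge between distinct vertices has exactly one orientation from `u` to `v`.
theorem adjMatrix_apply_eq_card (u v : V(G)) :
    G.adjMatrix u v =
      ((Finset.univ.filter fun a : G.OrientedEdge => a.src = u ∧ a.tgt = v).card : ℝ) := by
  have hcard : ∀ p : β → Prop, (∀ e, p e → e ∈ E(G)) →
      {e | p e}.ncard = ∑ e : E(G), if p e then 1 else 0 := by
    intro p hp
    rw [← Finset.card_filter, ← Set.ncard_coe_finset,
      ← Set.ncard_image_of_injective _ (Subtype.val_injective (p := fun e => e ∈ E(G)))]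
    congr 1
    ext e
    simpa using hp e
  simp only [adjMatrix, Matrix.of_apply]
  rw [hcard (fun e => G.IsLoopAt e u) fun e h => IsLink.edge_mem h,
    hcard (fun e => G.IsLink e u v) fun e h => IsLink.edge_mem h,
    Finset.card_filter, ← equivProd.symm.sum_comp, Fintype.sum_prod_type]
  obtain ⟨u, hu⟩ := u
  obtain ⟨v, hv⟩ := v
  split_ifs with h
  · simp only [Subtype.mk.injEq] at h
    subst h
    norm_cast
    rw [Finset.mul_sum]
    refine Finset.sum_congr rfl fun e _ => ?_
    have hl := G.isLink_ends e
    simp only [Fintype.sum_bool, equivProd, Equiv.coe_fn_symm_mk, src, tgt, origin, terminus,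
      if_true, Bool.false_eq_true, if_false, IsLoopAt, hl.isLink_iff, Subtype.mk.injEq]
    by_cases h1 : (G.ends e).1 = u <;> by_cases h2 : (G.ends e).2 = u <;> simp [h1, h2]
  · simp only [Subtype.mk.injEq] at h
    norm_cast
    refine Finset.sum_congr rfl fun e _ => ?_
    have hl := G.isLink_ends e
    simp only [Fintype.sum_bool, equivProd, Equiv.coe_fn_symm_mk, src, tgt, origin, terminus,
      if_true, Bool.false_eq_true, if_false, hl.isLink_iff, Subtype.mk.injEq]
    generalize (G.ends e).1 = a
    generalize (G.ends e).2 = b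
    by_cases h1 : a = u
    · subst h1
      by_cases h2 : b = v <;> simp [h2, h]
    · by_cases h2 : b = u <;> simp [h1, h2]

theorem adjMatrix_isHermitian [Fintype V(G)] : G.adjMatrix.IsHermitian := by
  classical
  refine Matrix.IsHermitian.ext fun u v => ?_
  simp only [adjMatrix_apply_eq_card, star_trivial, Nat.cast_inj]
  refine Finset.card_bij (fun a _ => a.inv) ?_ (fun a _ b _ h => invEquiv.injective h) ?_
  · simp +contextual
  · intro b hb
    exact ⟨b.inv, by simpa [and_comm] using hb, inv_inv b⟩

open Classical in
/-- Summing over the oriented edges according to their origins. -/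
theorem sum_src_mul [Fintype V(G)] (z : G.OrientedEdge → ℝ) (φ : V(G) → ℝ) :
    ∑ a : G.OrientedEdge, z a * φ a.src =
      ∑ v, (∑ a : G.OrientedEdge with a.src = v, z a) * φ v := by
  rw [← Finset.sum_fiberwise _ (fun a : G.OrientedEdge => a.src)]
  refine Finset.sum_congr rfl fun v _ => ?_
  rw [Finset.sum_mul]
  refine Finset.sum_congr rfl fun a ha => ?_
  rw [(Finset.mem_filter.1 ha).2]

open Classical in
theorem adjMatrix_mulVec [Fintype V(G)] (φ : V(G) → ℝ) (v : V(G)) :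
    (G.adjMatrix.mulVec φ) v = ∑ a : G.OrientedEdge with a.src = v, φ a.tgt := by
  rw [← Finset.sum_fiberwise _ (fun a : G.OrientedEdge => a.tgt)]
  simp only [Matrix.mulVec, dotProduct, adjMatrix_apply_eq_card]
  refine Finset.sum_congr rfl fun u _ => ?_
  rw [Finset.filter_filter, Finset.sum_congr rfl (g := fun _ => φ u) fun a ha => by
    rw [(Finset.mem_filter.1 ha).2.2]]
  simp

end Counting

/-! ### The non-backtracking matrix over the reals -/

/-- The non-backtracking matrix with real entries. -/
noncomputable def realNonBacktrackingMatrix (G : Graph α β) :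
    Matrix G.OrientedEdge G.OrientedEdge ℝ :=
  G.nonBacktrackingMatrix.map Nat.cast

variable [Fintype E(G)]

open Classical in
-- The successors of `e` form the star at its terminal vertex with `e.inv` removed, and `e.inv` does
-- belong to that star.
theorem realNonBacktrackingMatrix_mulVec (z : G.OrientedEdge → ℝ) (e : G.OrientedEdge) :
    (G.realNonBacktrackingMatrix.mulVec z) e =
      (∑ f : G.OrientedEdge with f.src = e.tgt, z f) - z e.inv := by
  have hmem : e.inv ∈ Finset.univ.filter fun f : G.OrientedEdge => f.src = e.tgt := by simp
  rw [← Finset.sum_erase_eq_sub hmem, Matrix.mulVec, dotProduct]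
  simp only [realNonBacktrackingMatrix, Matrix.map_apply, nonBacktrackingMatrix, Matrix.of_apply,
    Nat.cast_ite, Nat.cast_one, Nat.cast_zero, ite_mul, one_mul, zero_mul]
  rw [← Finset.sum_filter]
  refine Finset.sum_congr ?_ fun _ _ => rfl
  ext f
  simp [src, tgt, eq_comm, and_comm]

theorem realNonBacktrackingMatrix_mulVec_src {d : ℕ} (hG : G.IsRegularOfDegree (d + 1))
    (φ : V(G) → ℝ) :
    G.realNonBacktrackingMatrix.mulVec (φ ∘ src) = (d : ℝ) • (φ ∘ tgt) := by
  classical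
  ext e
  rw [realNonBacktrackingMatrix_mulVec, Finset.sum_congr rfl (g := fun _ => φ e.tgt) fun f hf => by
    rw [Function.comp_apply, (Finset.mem_filter.1 hf).2]]
  simp [card_src_eq hG]
  ring

/-- The full star contributes the adjacency matrix, and the forbidden edge `e.inv` ends at the
origin of `e`. With `realNonBacktrackingMatrix_mulVec_src`, this describes the action on pairs `φ ∘
src`, `φ ∘ tgt`. -/
theorem realNonBacktrackingMatrix_mulVec_tgt [Fintype V(G)] (φ : V(G) → ℝ) :
    G.realNonBacktrackingMatrix.mulVec (φ ∘ tgt) =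
      (G.adjMatrix.mulVec φ) ∘ tgt - φ ∘ src := by
  classical
  ext e
  simp [realNonBacktrackingMatrix_mulVec, adjMatrix_mulVec]

open Classical in
theorem realNonBacktrackingMatrix_mulVec_of_sum_eq_zero {z : G.OrientedEdge → ℝ}
    (hz : ∀ v, ∑ a : G.OrientedEdge with a.src = v, z a = 0) :
    G.realNonBacktrackingMatrix.mulVec z = - (z ∘ inv) := by
  ext e
  simp [realNonBacktrackingMatrix_mulVec, hz]

theorem sum_realNonBacktrackingMatrix_mulVec {d : ℕ} (hG : G.IsRegularOfDegree (d + 1))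
    (z : G.OrientedEdge → ℝ) :
    ∑ e, (G.realNonBacktrackingMatrix.mulVec z) e = d * ∑ e, z e := by
  simp only [Matrix.mulVec, dotProduct]
  rw [Finset.sum_comm, Finset.mul_sum]
  refine Finset.sum_congr rfl fun f _ => ?_
  rw [← Finset.sum_mul]
  congr 1
  have := (G.isRegularTransition_nonBacktrackingMatrix hG).col_sum f
  simp only [realNonBacktrackingMatrix, Matrix.map_apply]
  exact_mod_cast this

theorem sum_comp_tgt [Fintype V(G)] (φ : V(G) → ℝ) :
    ∑ e : G.OrientedEdge, φ e.tgt = ∑ e : G.OrientedEdge, φ e.src := by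
  rw [← invEquiv.sum_comp]
  simp

end Graph

/-! ### Growth comparison and the scalar recurrence -/

/-- An exponential does not stay below a linear multiple of a smaller exponential. -/
theorem nonpos_of_mul_pow_le {a C r t : ℝ} (hr : 0 ≤ r) (hrt : r < t)
    (h : ∀ n : ℕ, a * t ^ n ≤ C * (n + 1) * r ^ n) : a ≤ 0 := by
  have ht : 0 < t := hr.trans_lt hrt
  have hq : |r / t| < 1 := by
    rw [abs_of_nonneg (div_nonneg hr ht.le)]
    exact (div_lt_one ht).2 hrt
  have h1 := ((tendsto_self_mul_const_pow_of_abs_lt_one hq).add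
    (tendsto_pow_atTop_nhds_zero_of_abs_lt_one hq)).const_mul C
  rw [add_zero, mul_zero] at h1
  refine ge_of_tendsto' h1 fun n => ?_
  have h2 := h n
  rw [← le_div_iff₀ (pow_pos ht n)] at h2
  refine h2.trans_eq ?_
  rw [div_pow]
  ring

/-- The solution of `u (n + 2) = a u (n + 1) - b u n` with `u 0 = 0` and `u 1 = 1`. -/
def lucasSeq (a b : ℝ) : ℕ → ℝ
  | 0 => 0
  | 1 => 1
  | n + 2 => a * lucasSeq a b (n + 1) - b * lucasSeq a b n

namespace Graph

variable {α β : Type*} {G : Graph α β}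

open OrientedEdge

/-! ### Eigenfunctions for the extreme eigenvalues -/

theorem Connected.eq_of_src_eq_tgt {γ : Type*} (hc : G.Connected) {ψ : V(G) → γ}
    (h : ∀ a : G.OrientedEdge, ψ a.src = ψ a.tgt) (u v : V(G)) : ψ u = ψ v := by
  have key : ∀ x, Relation.ReflTransGen G.Adj u x → ∀ hx : x ∈ V(G), ψ u = ψ ⟨x, hx⟩ := by
    intro x hx
    induction hx with
    | refl => exact fun _ => rfl
    | tail _ hbc ih =>
      intro hx
      obtain ⟨e, he⟩ := hbc
      obtain ⟨a, rfl, rfl⟩ := exists_of_isLink he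
      exact (ih he.left_mem).trans (h a)
  exact key v (hc.2 u u.2 v v.2) v.2

section

variable [Fintype V(G)] [Fintype E(G)]

/-- The Dirichlet form settles this: the sum of `(φ a.src - s φ a.tgt) ^ 2` over all oriented edges
is `2 (d + 1) (1 - s ^ 2) ∑ φ v ^ 2 = 0`, so every summand vanishes. -/
theorem eigenfunction_src_eq {d : ℕ} (hG : G.IsRegularOfDegree (d + 1)) {φ : V(G) → ℝ} {s : ℝ}
    (hs : s ^ 2 = 1) (hφ : G.adjMatrix.mulVec φ = (s * (d + 1)) • φ) (a : G.OrientedEdge) :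
    φ a.src = s * φ a.tgt := by
  classical
  have h1 : ∑ a : G.OrientedEdge, φ a.src * φ a.src = (d + 1) * ∑ v, φ v * φ v := by
    rw [sum_src_mul (fun a => φ a.src) φ, Finset.mul_sum]
    refine Finset.sum_congr rfl fun v _ => ?_
    rw [Finset.sum_congr rfl (g := fun _ => φ v) fun f hf => by rw [(Finset.mem_filter.1 hf).2]]
    simp [card_src_eq hG, mul_assoc]
  have h2 : ∑ a : G.OrientedEdge, φ a.tgt * φ a.tgt = (d + 1) * ∑ v, φ v * φ v := by
    rw [← h1]
    exact sum_comp_tgt fun v => φ v * φ v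
  have h3 : ∑ a : G.OrientedEdge, φ a.tgt * φ a.src = s * (d + 1) * ∑ v, φ v * φ v := by
    rw [sum_src_mul (fun a => φ a.tgt) φ, Finset.mul_sum]
    refine Finset.sum_congr rfl fun v _ => ?_
    rw [← adjMatrix_mulVec, hφ]
    simp [mul_assoc]
  have h4 : ∑ a : G.OrientedEdge, (φ a.src - s * φ a.tgt) ^ 2 = 0 := by
    have : ∀ a : G.OrientedEdge, (φ a.src - s * φ a.tgt) ^ 2 =
        φ a.src * φ a.src + φ a.tgt * φ a.tgt - 2 * s * (φ a.tgt * φ a.src) := by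
      intro a
      linear_combination φ a.tgt ^ 2 * hs
    simp only [this]
    rw [Finset.sum_sub_distrib, Finset.sum_add_distrib, ← Finset.mul_sum, h1, h2, h3]
    linear_combination (-2 * (d + 1) * ∑ v, φ v * φ v) * hs
  have h5 := (Finset.sum_eq_zero_iff_of_nonneg fun a _ => sq_nonneg _).1 h4 a (Finset.mem_univ a)
  exact sub_eq_zero.1 (pow_eq_zero_iff two_ne_zero |>.1 h5)

theorem Connected.eigenfunction_eq {d : ℕ} (hc : G.Connected) (hG : G.IsRegularOfDegree (d + 1))
    {φ : V(G) → ℝ} (hφ : G.adjMatrix.mulVec φ = ((d : ℝ) + 1) • φ) (u v : V(G)) : φ u = φ v :=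
  hc.eq_of_src_eq_tgt (fun a => by
    simpa using eigenfunction_src_eq hG (s := 1) (by norm_num) (by simpa using hφ) a) u v

/-- The sign of `φ` is the two-colouring. Since `φ` changes sign along every edge, `φ ^ 2` is
constant on the connected graph, so `φ` vanishes nowhere. -/
theorem Connected.isBipartite_of_eigenfunction {d : ℕ} (hc : G.Connected)
    (hG : G.IsRegularOfDegree (d + 1)) {φ : V(G) → ℝ}
    (hφ : G.adjMatrix.mulVec φ = (-((d : ℝ) + 1)) • φ) (h0 : φ ≠ 0) : G.IsBipartite := by
  classical
  have h1 : ∀ a : G.OrientedEdge, φ a.src = - φ a.tgt := fun a => by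
    simpa using eigenfunction_src_eq hG (s := -1) (by norm_num) (by simpa using hφ) a
  obtain ⟨u, hu⟩ := Function.ne_iff.1 h0
  have hne : ∀ v, φ v ≠ 0 := by
    intro v hv
    have := hc.eq_of_src_eq_tgt (ψ := fun v => φ v ^ 2) (fun a => by simp [h1]) u v
    simp only [hv] at this
    exact hu (by simpa using this)
  refine ⟨fun x => if h : x ∈ V(G) then decide (0 < φ ⟨x, h⟩) else false, fun e x y he => ?_⟩
  obtain ⟨a, rfl, rfl⟩ := exists_of_isLink he
  have h2 := h1 a
  have h3 := hne a.tgt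
  simp only [src, tgt] at h2 h3
  beta_reduce
  rw [dif_pos he.left_mem, dif_pos he.right_mem, h2, Ne, decide_eq_decide]
  rcases lt_or_gt_of_ne h3 with h | h
  · simp [h, h.le]
  · simp [h, h.le]

theorem IsBipartite.exists_eigenfunction {d : ℕ} (hb : G.IsBipartite)
    (hG : G.IsRegularOfDegree (d + 1)) (hV : V(G).Nonempty) :
    ∃ φ : V(G) → ℝ, φ ≠ 0 ∧ G.adjMatrix.mulVec φ = (-((d : ℝ) + 1)) • φ := by
  classical
  obtain ⟨c, hc⟩ := hb
  obtain ⟨x, hx⟩ := hV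
  refine ⟨fun v => if c v then 1 else -1, fun h => ?_, ?_⟩
  · have := congrFun h ⟨x, hx⟩
    simp only [Pi.zero_apply] at this
    split_ifs at this <;> norm_num at this
  · ext v
    rw [adjMatrix_mulVec, Finset.sum_congr rfl (g := fun _ => - if c v then (1 : ℝ) else -1)
      fun a ha => ?_]
    · simp [card_src_eq hG]
      split_ifs <;> ring
    · obtain rfl := (Finset.mem_filter.1 ha).2
      have := hc _ _ _ a.isLink
      simp only [src, tgt]
      by_cases h1 : c a.origin = true <;> by_cases h2 : c a.terminus = true <;> simp_all

end

/-! ### Decay of the powers of the non-backtracking matrix -/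

variable [Fintype E(G)]

theorem mean_mulVec {d : ℕ} (hG : G.IsRegularOfDegree (d + 1)) (z : G.OrientedEdge → ℝ) :
    (∑ e, (G.realNonBacktrackingMatrix.mulVec z) e) / Fintype.card G.OrientedEdge =
      d * ((∑ e, z e) / Fintype.card G.OrientedEdge) := by
  rw [sum_realNonBacktrackingMatrix_mulVec hG, mul_div_assoc]

open Classical in
/-- The functions whose iterates under the non-backtracking matrix approach `d ^ n` times their mean
with error `O(n √d ^ n)`. -/
noncomputable def decaySubmodule (G : Graph α β) [Fintype E(G)] (d : ℕ) :
    Submodule ℝ (G.OrientedEdge → ℝ) where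
  carrier := {z | ∃ C : ℝ, ∀ (n : ℕ) (e : G.OrientedEdge),
    |((G.realNonBacktrackingMatrix ^ n).mulVec z) e -
      d ^ n * ((∑ f, z f) / Fintype.card G.OrientedEdge)| ≤ C * (n + 1) * √d ^ n}
  zero_mem' := ⟨0, fun n e => by simp⟩
  add_mem' := by
    rintro y z ⟨C, hC⟩ ⟨D, hD⟩
    refine ⟨C + D, fun n e => ?_⟩
    have := (abs_add_le _ _).trans (add_le_add (hC n e) (hD n e))
    refine (le_of_eq ?_).trans (this.trans_eq (by ring))
    congr 1
    simp only [Matrix.mulVec_add, Pi.add_apply, Finset.sum_add_distrib]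
    ring
  smul_mem' := by
    rintro c z ⟨C, hC⟩
    refine ⟨|c| * C, fun n e => ?_⟩
    have := mul_le_mul_of_nonneg_left (hC n e) (abs_nonneg c)
    rw [← abs_mul] at this
    refine (le_of_eq ?_).trans (this.trans_eq (by ring))
    congr 1
    simp only [Matrix.mulVec_smul, Pi.smul_apply, smul_eq_mul, ← Finset.mul_sum]
    ring

open Classical in
theorem mem_decaySubmodule {d : ℕ} {z : G.OrientedEdge → ℝ} :
    z ∈ G.decaySubmodule d ↔ ∃ C : ℝ, ∀ (n : ℕ) (e : G.OrientedEdge),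
      |((G.realNonBacktrackingMatrix ^ n).mulVec z) e -
        d ^ n * ((∑ f, z f) / Fintype.card G.OrientedEdge)| ≤ C * (n + 1) * √d ^ n := Iff.rfl

/-- The iterates of `z` from the first on are those of its image, whose mean is `d` times that of
`z`. This passes decay from `φ ∘ tgt` to `φ ∘ src`. -/
theorem mem_decaySubmodule_of_mulVec_mem {d : ℕ} (hd : 1 ≤ d) (hG : G.IsRegularOfDegree (d + 1))
    {z : G.OrientedEdge → ℝ} (h : G.realNonBacktrackingMatrix.mulVec z ∈ G.decaySubmodule d) :
    z ∈ G.decaySubmodule d := by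
  classical
  obtain ⟨C, hC⟩ := mem_decaySubmodule.1 h
  have hr : 1 ≤ √(d : ℝ) := Real.one_le_sqrt.2 (by exact_mod_cast hd)
  set m := (∑ f, z f) / (Fintype.card G.OrientedEdge : ℝ)
  -- The sum over edges serves `n = 0`, about which the hypothesis on the image says nothing.
  refine mem_decaySubmodule.2 ⟨|C| + ∑ e, |z e - m|, fun n e => ?_⟩
  have hS : |z e - m| ≤ ∑ e, |z e - m| :=
    Finset.single_le_sum (f := fun e => |z e - m|) (fun _ _ => abs_nonneg _) (Finset.mem_univ e)
  have hS0 := (abs_nonneg _).trans hS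
  cases n with
  | zero => simpa using hS.trans (le_add_of_nonneg_left (abs_nonneg C))
  | succ n =>
    have h1 := hC n e
    rw [Matrix.mulVec_mulVec, ← pow_succ, mean_mulVec hG, ← mul_assoc, ← pow_succ] at h1
    refine h1.trans ?_
    have h2 : √(d : ℝ) ^ n ≤ √(d : ℝ) ^ (n + 1) := pow_le_pow_right₀ hr n.le_succ
    have h3 := le_abs_self C
    push_cast
    gcongr <;> linarith

/-- One application of the matrix sends coefficients `(x, y)` of `φ ∘ tgt` and `φ ∘ src` to `(lam x
+ d y, -x)`, which is the recurrence of `lucasSeq lam d`. -/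
theorem pow_mulVec_tgt [Fintype V(G)] [DecidableEq G.OrientedEdge] {d : ℕ}
    (hG : G.IsRegularOfDegree (d + 1)) {φ : V(G) → ℝ}
    {lam : ℝ} (hφ : G.adjMatrix.mulVec φ = lam • φ) (n : ℕ) :
    (G.realNonBacktrackingMatrix ^ n).mulVec (φ ∘ tgt) =
      lucasSeq lam d (n + 1) • (φ ∘ tgt) - lucasSeq lam d n • (φ ∘ src) := by
  induction n with
  | zero => simp [lucasSeq]
  | succ n ih =>
    rw [pow_succ', ← Matrix.mulVec_mulVec, ih, Matrix.mulVec_sub, Matrix.mulVec_smul,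
      Matrix.mulVec_smul, realNonBacktrackingMatrix_mulVec_src hG,
      realNonBacktrackingMatrix_mulVec_tgt, hφ]
    ext e
    simp [lucasSeq]
    ring

/-- Let `S` be the sum. The image of `φ ∘ tgt` has sum `d S` by the column sums and `lam S - S` by
the explicit formula. -/
theorem sum_eq_zero_of_eigenfunction [Fintype V(G)] {d : ℕ} (hG : G.IsRegularOfDegree (d + 1))
    {φ : V(G) → ℝ} {lam : ℝ} (hφ : G.adjMatrix.mulVec φ = lam • φ) (hlam : lam ≠ d + 1) :
    ∑ e : G.OrientedEdge, φ e.tgt = 0 := by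
  have h := sum_realNonBacktrackingMatrix_mulVec hG (φ ∘ tgt)
  rw [realNonBacktrackingMatrix_mulVec_tgt, hφ] at h
  simp only [Pi.sub_apply, Function.comp_apply, Finset.sum_sub_distrib, Pi.smul_apply, smul_eq_mul,
    ← Finset.mul_sum, ← sum_comp_tgt] at h
  have : (lam - (d + 1)) * ∑ e : G.OrientedEdge, φ e.tgt = 0 := by linear_combination h
  exact (mul_eq_zero.1 this).resolve_left (sub_ne_zero.2 hlam)

theorem tgt_mem_decaySubmodule [Fintype V(G)] {d : ℕ} (hd : 1 ≤ d)
    (hG : G.IsRegularOfDegree (d + 1)) {φ : V(G) → ℝ} {lam : ℝ}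
    (hφ : G.adjMatrix.mulVec φ = lam • φ) (hne : lam ≠ d + 1) (hlam : |lam| ≤ 2 * √(d : ℝ)) :
    φ ∘ tgt ∈ G.decaySubmodule d := by
  classical
  obtain ⟨C, hC0, hC⟩ := abs_le_of_recurrence (u := lucasSeq lam d) (by exact_mod_cast hd) hlam
    fun n => rfl
  have hr : 0 ≤ √(d : ℝ) := Real.sqrt_nonneg _
  -- The term with index `n + 1` costs `C (n + 2) √d ^ (n + 1) ≤ 2 C √d (n + 1) √d ^ n`, the term
  -- with index `n` costs `C (n + 1) √d ^ n`, and `∑ v, |φ v|` bounds the values of `φ`.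
  refine mem_decaySubmodule.2 ⟨(2 * C * √d + C) * ∑ v, |φ v|, fun n e => ?_⟩
  have hb : ∀ v, |φ v| ≤ ∑ v, |φ v| := fun v =>
    Finset.single_le_sum (f := fun v => |φ v|) (fun _ _ => abs_nonneg _) (Finset.mem_univ v)
  have hB0 := (abs_nonneg _).trans (hb e.tgt)
  have hsum : ∑ f : G.OrientedEdge, (φ ∘ tgt) f = 0 := sum_eq_zero_of_eigenfunction hG hφ hne
  rw [hsum, pow_mulVec_tgt hG hφ, zero_div, mul_zero, sub_zero]
  simp only [Pi.sub_apply, Pi.smul_apply, smul_eq_mul, Function.comp_apply]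
  refine (abs_sub _ _).trans ?_
  rw [abs_mul, abs_mul]
  have h1 := mul_le_mul (hC (n + 1)) (hb e.tgt) (abs_nonneg _) (by positivity)
  have h2 := mul_le_mul (hC n) (hb e.src) (abs_nonneg _) (by positivity)
  refine (add_le_add h1 h2).trans ?_
  have h3 : (((n + 1 : ℕ) : ℝ) + 1) ≤ 2 * (n + 1) := by push_cast; linarith [n.cast_nonneg (α := ℝ)]
  have h4 : C * (((n + 1 : ℕ) : ℝ) + 1) * √(d : ℝ) ^ (n + 1) * ∑ v, |φ v| ≤
      C * (2 * (n + 1)) * √(d : ℝ) ^ (n + 1) * ∑ v, |φ v| := by gcongr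
  refine (add_le_add_left h4 _).trans_eq ?_
  rw [pow_succ]
  ring

theorem const_mem_decaySubmodule {d : ℕ} (hG : G.IsRegularOfDegree (d + 1)) (c : ℝ) :
    (fun _ => c) ∈ G.decaySubmodule d := by
  classical
  refine mem_decaySubmodule.2 ⟨0, fun n e => ?_⟩
  have : Nonempty G.OrientedEdge := ⟨e⟩
  have h : ∀ n : ℕ, (G.realNonBacktrackingMatrix ^ n).mulVec (fun _ => c) =
      fun _ => (d : ℝ) ^ n * c := by
    intro n
    induction n generalizing c with
    | zero => simp
    | succ n ih =>
      have h1 := realNonBacktrackingMatrix_mulVec_src hG fun _ => c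
      rw [pow_succ, ← Matrix.mulVec_mulVec]
      erw [h1]
      have := ih (d * c)
      erw [this]
      ext
      ring
  rw [h]
  simp

open Classical in
-- With vanishing star sums the matrix acts as minus inversion. Inversion exchanges the two
-- hypotheses, so they persist, and all iterates are signed rearrangements of `z`, hence bounded.
theorem mem_decaySubmodule_of_sum_eq_zero [Fintype V(G)] {d : ℕ} (hd : 1 ≤ d)
    {z : G.OrientedEdge → ℝ}
    (h1 : ∀ v, ∑ a : G.OrientedEdge with a.src = v, z a = 0)
    (h2 : ∀ v, ∑ a : G.OrientedEdge with a.tgt = v, z a = 0) :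
    z ∈ G.decaySubmodule d := by
  have hr : 1 ≤ √(d : ℝ) := Real.one_le_sqrt.2 (by exact_mod_cast hd)
  have hinv : ∀ y : G.OrientedEdge → ℝ, (∀ v, ∑ a : G.OrientedEdge with a.tgt = v, y a = 0) →
      ∀ v, ∑ a : G.OrientedEdge with a.src = v, y a.inv = 0 := by
    intro y hy v
    rw [← hy v, Finset.sum_filter, Finset.sum_filter, ← invEquiv.sum_comp]
    simp
  have hinv' : ∀ y : G.OrientedEdge → ℝ, (∀ v, ∑ a : G.OrientedEdge with a.src = v, y a = 0) →
      ∀ v, ∑ a : G.OrientedEdge with a.tgt = v, y a.inv = 0 := by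
    intro y hy v
    rw [← hy v, Finset.sum_filter, Finset.sum_filter, ← invEquiv.sum_comp]
    simp
  have hs : ∑ a, z a = 0 := by
    rw [← Finset.sum_fiberwise _ (fun a : G.OrientedEdge => a.src)]
    exact Finset.sum_eq_zero fun v _ => h1 v
  refine mem_decaySubmodule.2 ⟨∑ a, |z a|, fun n e => ?_⟩
  have key : ∀ (n : ℕ) (y : G.OrientedEdge → ℝ),
      (∀ v, ∑ a : G.OrientedEdge with a.src = v, y a = 0) →
      (∀ v, ∑ a : G.OrientedEdge with a.tgt = v, y a = 0) →
      ∀ e, |((G.realNonBacktrackingMatrix ^ n).mulVec y) e| ≤ ∑ a, |y a| := by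
    intro n
    induction n with
    | zero =>
      intro y _ _ e
      simpa using Finset.single_le_sum (f := fun e => |y e|) (fun _ _ => abs_nonneg _)
        (Finset.mem_univ e)
    | succ n ih =>
      intro y hy1 hy2 e
      rw [pow_succ, ← Matrix.mulVec_mulVec, realNonBacktrackingMatrix_mulVec_of_sum_eq_zero hy1,
        Matrix.mulVec_neg, Pi.neg_apply, abs_neg]
      refine (ih (y ∘ inv) (hinv y hy2) (hinv' y hy1) e).trans_eq ?_
      exact invEquiv.sum_comp fun a => |y a|
  rw [hs, zero_div, mul_zero, sub_zero, mul_assoc]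
  refine (key n z h1 h2 e).trans (le_mul_of_one_le_right (Finset.sum_nonneg fun _ _ =>
    abs_nonneg _) (one_le_mul_of_one_le_of_one_le ?_ (one_le_pow₀ hr)))
  linarith [n.cast_nonneg (α := ℝ)]

/-- A subspace which contains all functions of the origin, all functions of the terminal vertex, and
everything orthogonal to them, is the whole space. -/
theorem eq_top_of_src_tgt_mem [Fintype V(G)] {W : Submodule ℝ (G.OrientedEdge → ℝ)}
    (h1 : ∀ φ : V(G) → ℝ, φ ∘ src ∈ W) (h2 : ∀ φ : V(G) → ℝ, φ ∘ tgt ∈ W)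
    (h3 : ∀ z : G.OrientedEdge → ℝ, (∀ φ : V(G) → ℝ, ∑ a, z a * φ a.src = 0) →
      (∀ φ : V(G) → ℝ, ∑ a, z a * φ a.tgt = 0) → z ∈ W) : W = ⊤ := by
  classical
  by_contra hW
  -- A functional vanishing on `W` is the dot product with some `z`. Being orthogonal to the first
  -- two families, `z` lies in `W` itself, so `z ⬝ᵥ z = 0`.
  obtain ⟨f, hf0, hf⟩ := W.exists_le_ker_of_lt_top (lt_top_iff_ne_top.2 hW)
  obtain ⟨z, rfl⟩ := (dotProductEquiv ℝ G.OrientedEdge).surjective f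
  have hz : z ∈ W := h3 z (fun φ => hf (h1 φ)) (fun φ => hf (h2 φ))
  have : z ⬝ᵥ z = 0 := hf hz
  rw [dotProduct_self_eq_zero] at this
  exact hf0 (by rw [this, map_zero])

/-- The spectral theorem for the symmetric adjacency matrix reduces `φ ∘ tgt` to eigenfunctions.
Those for `d + 1` are constant by connectedness, `-(d + 1)` would make the graph bipartite, and all
others obey the bound `2 √d`. -/
theorem IsRamanujan.decaySubmodule_eq_top [Fintype V(G)] {d : ℕ} (hd : 1 ≤ d)
    (hR : G.IsRamanujan d) (hb : ¬ G.IsBipartite) : G.decaySubmodule d = ⊤ := by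
  classical
  have hG := hR.regular
  have htgt : ∀ φ : V(G) → ℝ, φ ∘ tgt ∈ G.decaySubmodule d := by
    intro φ
    have hA := adjMatrix_isHermitian (G := G)
    have hbasis : ∀ j, (hA.eigenvectorBasis j).ofLp ∘ tgt ∈ G.decaySubmodule d := by
      intro j
      set ψ : V(G) → ℝ := (hA.eigenvectorBasis j).ofLp with hψ
      have h1 : G.adjMatrix.mulVec ψ = hA.eigenvalues j • ψ := hA.mulVec_eigenvectorBasis j
      have h0 : ψ ≠ 0 := by
        intro h
        exact hA.eigenvectorBasis.orthonormal.ne_zero j (by ext v; exact congrFun h v)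
      have hev : Module.End.HasEigenvalue G.adjMatrix.mulVecLin (hA.eigenvalues j) :=
        Module.End.hasEigenvalue_of_hasEigenvector
          (x := ψ) ⟨Module.End.mem_eigenspace_iff.2 h1, h0⟩
      by_cases hne : hA.eigenvalues j = d + 1
      · rw [hne] at h1
        obtain ⟨v⟩ : Nonempty V(G) := ⟨j⟩
        have : ψ ∘ tgt = fun _ : G.OrientedEdge => ψ v := by
          ext a
          exact hR.connected.eigenfunction_eq hG h1 _ _
        rw [this]
        exact const_mem_decaySubmodule hG _
      · rcases hR.eigenvalue _ hev with h | h | h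
        · exact absurd h hne
        · rw [h] at h1
          exact absurd (hR.connected.isBipartite_of_eigenfunction hG h1 h0) hb
        · exact tgt_mem_decaySubmodule hd hG h1 hne h
    have hsum := hA.eigenvectorBasis.sum_repr (WithLp.toLp 2 φ)
    have : φ ∘ tgt = ∑ j, (hA.eigenvectorBasis.repr (WithLp.toLp 2 φ)).ofLp j •
        ((hA.eigenvectorBasis j).ofLp ∘ (tgt : G.OrientedEdge → V(G))) := by
      ext a
      have := congrArg (fun x : EuclideanSpace ℝ V(G) => x.ofLp a.tgt) hsum
      simp only [WithLp.ofLp_sum, WithLp.ofLp_smul, Finset.sum_apply, Pi.smul_apply] at this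
      simpa [Finset.sum_apply] using this.symm
    rw [this]
    exact Submodule.sum_mem _ fun j _ => Submodule.smul_mem _ _ (hbasis j)
  refine eq_top_of_src_tgt_mem (fun φ => ?_) htgt fun z h1 h2 => ?_
  · refine mem_decaySubmodule_of_mulVec_mem hd hG ?_
    rw [realNonBacktrackingMatrix_mulVec_src hG]
    exact Submodule.smul_mem _ _ (htgt φ)
  · refine mem_decaySubmodule_of_sum_eq_zero hd (fun v => ?_) fun v => ?_
    · rw [Finset.sum_filter]
      simpa using h1 fun u => if u = v then 1 else 0
    · rw [Finset.sum_filter]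
      simpa using h2 fun u => if u = v then 1 else 0

/-! ### Decay forces the graph to be Ramanujan and not bipartite -/

theorem pow_mulVec_of_mulVec_eq [DecidableEq G.OrientedEdge] {z : G.OrientedEdge → ℝ} {θ : ℝ}
    (h : G.realNonBacktrackingMatrix.mulVec z = θ • z) (n : ℕ) :
    (G.realNonBacktrackingMatrix ^ n).mulVec z = θ ^ n • z := by
  induction n with
  | zero => simp
  | succ n ih => rw [pow_succ, ← Matrix.mulVec_mulVec, h, Matrix.mulVec_smul, ih, smul_smul, pow_succ']

/-- The column sums force an eigenvector with `θ ≠ d` to have mean zero. Decay then bounds `|θ| ^ n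
|z e|` by a multiple of `(n + 1) √d ^ n`. -/
theorem abs_le_sqrt_of_mem_decaySubmodule {d : ℕ} (hG : G.IsRegularOfDegree (d + 1))
    {z : G.OrientedEdge → ℝ} {θ : ℝ} (h : G.realNonBacktrackingMatrix.mulVec z = θ • z)
    (hz : z ∈ G.decaySubmodule d) (h0 : z ≠ 0) (hθ : θ ≠ d) : |θ| ≤ √(d : ℝ) := by
  classical
  by_contra! hlt
  obtain ⟨C, hC⟩ := mem_decaySubmodule.1 hz
  obtain ⟨e, he⟩ := Function.ne_iff.1 h0
  have hs : ∑ f, z f = 0 := by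
    have h1 := sum_realNonBacktrackingMatrix_mulVec hG z
    simp only [h, Pi.smul_apply, smul_eq_mul, ← Finset.mul_sum] at h1
    have h2 : (θ - d) * ∑ f, z f = 0 := by linear_combination h1
    exact (mul_eq_zero.1 h2).resolve_left (sub_ne_zero.2 hθ)
  have h1 : |z e| ≤ 0 := nonpos_of_mul_pow_le (Real.sqrt_nonneg _) hlt fun n => by
    have := hC n e
    rwa [hs, pow_mulVec_of_mulVec_eq h, zero_div, mul_zero, sub_zero, Pi.smul_apply, smul_eq_mul,
      abs_mul, abs_pow, mul_comm] at this
  exact he (abs_nonpos_iff.1 h1)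

/-- The deviation of `z` from its mean is multiplied by exactly `d ^ n`, and `√d < d`, so it must
vanish. -/
theorem eq_of_mem_decaySubmodule {d : ℕ} (hd : 2 ≤ d)
    {z : G.OrientedEdge → ℝ} (h : G.realNonBacktrackingMatrix.mulVec z = (d : ℝ) • z)
    (hz : z ∈ G.decaySubmodule d) (e f : G.OrientedEdge) : z e = z f := by
  classical
  obtain ⟨C, hC⟩ := mem_decaySubmodule.1 hz
  have hd1 : (1 : ℝ) < d := by exact_mod_cast hd
  have hlt : √(d : ℝ) < d := by
    rw [Real.sqrt_lt' (by linarith)]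
    nlinarith
  have key : ∀ e, z e = (∑ f, z f) / Fintype.card G.OrientedEdge := by
    intro e
    have h1 : |z e - (∑ f, z f) / Fintype.card G.OrientedEdge| ≤ 0 :=
      nonpos_of_mul_pow_le (Real.sqrt_nonneg _) hlt fun n => by
        have := hC n e
        rwa [pow_mulVec_of_mulVec_eq h, Pi.smul_apply, smul_eq_mul, ← mul_sub, abs_mul, abs_pow,
          Nat.abs_cast, mul_comm] at this
    exact sub_eq_zero.1 (abs_nonpos_iff.1 h1)
  rw [key e, key f]

theorem connected_of_decaySubmodule_eq_top {d : ℕ} (hd : 2 ≤ d)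
    (hG : G.IsRegularOfDegree (d + 1)) (hV : V(G).Nonempty) (h : G.decaySubmodule d = ⊤) :
    G.Connected := by
  classical
  refine ⟨hV, fun u hu v hv => ?_⟩
  -- The indicator of the component of `u` takes equal values at the two ends of every edge, so its
  -- lift to oriented edges is an eigenvector for `d`, hence constant.
  let φ : V(G) → ℝ := fun w => if Relation.ReflTransGen G.Adj u w then 1 else 0
  have hφ : φ ∘ (tgt : G.OrientedEdge → V(G)) = φ ∘ src := by
    ext a
    have hadj : G.Adj a.origin a.terminus := ⟨_, a.isLink⟩
    have : Relation.ReflTransGen G.Adj u a.terminus ↔ Relation.ReflTransGen G.Adj u a.origin :=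
      ⟨fun h => h.tail hadj.symm, fun h => h.tail hadj⟩
    exact if_congr this rfl rfl
  have hz := realNonBacktrackingMatrix_mulVec_src hG φ
  rw [hφ] at hz
  obtain ⟨a, ha⟩ := exists_src_eq hG ⟨u, hu⟩
  obtain ⟨b, hb⟩ := exists_src_eq hG ⟨v, hv⟩
  have h1 := eq_of_mem_decaySubmodule hd hz (h ▸ Submodule.mem_top) a b
  simp only [Function.comp_apply, ha, hb, φ] at h1
  by_contra hn
  simp [hn, Relation.ReflTransGen.refl] at h1

theorem eigenvalue_of_decaySubmodule_eq_top [Fintype V(G)] {d : ℕ} (hd : 2 ≤ d)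
    (hG : G.IsRegularOfDegree (d + 1)) (h : G.decaySubmodule d = ⊤) {φ : V(G) → ℝ} {lam : ℝ}
    (hφ : G.adjMatrix.mulVec φ = lam • φ) (h0 : φ ≠ 0) :
    lam = d + 1 ∨ |lam| ≤ 2 * √(d : ℝ) := by
  classical
  by_contra! hlam
  obtain ⟨hne, hlt⟩ := hlam
  have hd1 : (1 : ℝ) < d := by exact_mod_cast hd
  have hr2 : √(d : ℝ) ^ 2 = d := Real.sq_sqrt (by linarith)
  have hr0 : 0 < √(d : ℝ) := Real.sqrt_pos.2 (by linarith)
  have hdisc : 4 * (d : ℝ) < lam ^ 2 := by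
    have := pow_lt_pow_left₀ hlt (by positivity) two_ne_zero
    rw [sq_abs, mul_pow, hr2] at this
    linarith
  -- the root of larger modulus
  obtain ⟨θ, hθ, hθr⟩ : ∃ θ : ℝ, θ ^ 2 - lam * θ + d = 0 ∧ √(d : ℝ) < |θ| := by
    have hs2 : √(lam ^ 2 - 4 * d) ^ 2 = lam ^ 2 - 4 * d := Real.sq_sqrt (by linarith)
    have hs0 : 0 ≤ √(lam ^ 2 - 4 * d) := Real.sqrt_nonneg _
    rcases le_total 0 lam with hl | hl
    · refine ⟨(lam + √(lam ^ 2 - 4 * d)) / 2, by linear_combination hs2 / 4, ?_⟩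
      rw [abs_of_nonneg hl] at hlt
      rw [abs_of_nonneg (by positivity)]
      linarith
    · refine ⟨(lam - √(lam ^ 2 - 4 * d)) / 2, by linear_combination hs2 / 4, ?_⟩
      rw [abs_of_nonpos hl] at hlt
      rw [abs_of_nonpos (by linarith)]
      linarith
  have hθ2 : (d : ℝ) < θ ^ 2 := by
    have := pow_lt_pow_left₀ hθr hr0.le two_ne_zero
    rwa [sq_abs, hr2] at this
  -- The eigenvector for the root `θ` of the two-dimensional action on `φ ∘ src` and `φ ∘ tgt`.
  set z : G.OrientedEdge → ℝ := φ ∘ src - θ • (φ ∘ tgt) with hzdef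
  have hz : G.realNonBacktrackingMatrix.mulVec z = θ • z := by
    rw [hzdef, Matrix.mulVec_sub, Matrix.mulVec_smul, realNonBacktrackingMatrix_mulVec_src hG,
      realNonBacktrackingMatrix_mulVec_tgt, hφ]
    ext e
    simp
    linear_combination φ e.tgt * hθ
  -- The star sums of `z` are `(d + 1 - θ lam) φ v = (1 - θ ^ 2) φ v`, and `θ ^ 2 > d > 1`.
  have hz0 : z ≠ 0 := by
    intro hz0
    refine h0 (funext fun v => ?_)
    have h1 : ∑ a : G.OrientedEdge with a.src = v, z a = (d + 1) * φ v - θ * (lam * φ v) := by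
      simp only [hzdef, Pi.sub_apply, Pi.smul_apply, Function.comp_apply, smul_eq_mul,
        Finset.sum_sub_distrib, ← Finset.mul_sum]
      rw [← adjMatrix_mulVec, hφ, Finset.sum_congr rfl (g := fun _ => φ v) fun f hf => by
        rw [(Finset.mem_filter.1 hf).2]]
      simp [card_src_eq hG]
    rw [hz0] at h1
    simp only [Pi.zero_apply, Finset.sum_const_zero] at h1
    have h2 : (1 - θ ^ 2) * φ v = 0 := by linear_combination -φ v * hθ - h1
    exact (mul_eq_zero.1 h2).resolve_left (by linarith)
  refine absurd (abs_le_sqrt_of_mem_decaySubmodule hG hz (h ▸ Submodule.mem_top) hz0 ?_)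
    hθr.not_ge
  -- The root `θ = d` forces `lam = d + 1`, which is excluded.
  rintro rfl
  refine hne ?_
  have : (d : ℝ) * (lam - (d + 1)) = 0 := by linear_combination -hθ
  exact sub_eq_zero.1 ((mul_eq_zero.1 this).resolve_left (by linarith))

/-- A two-colouring gives the eigenvalue `-(d + 1)`, too large because `d + 1 - 2 √d = (√d - 1) ^ 2
> 0`. -/
theorem not_isBipartite_of_decaySubmodule_eq_top [Fintype V(G)] {d : ℕ} (hd : 2 ≤ d)
    (hG : G.IsRegularOfDegree (d + 1)) (hV : V(G).Nonempty) (h : G.decaySubmodule d = ⊤) :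
    ¬ G.IsBipartite := by
  intro hb
  obtain ⟨φ, h0, hφ⟩ := hb.exists_eigenfunction hG hV
  have hd1 : (1 : ℝ) < d := by exact_mod_cast hd
  have hr2 : √(d : ℝ) ^ 2 = d := Real.sq_sqrt (by linarith)
  have hr1 : 1 < √(d : ℝ) := by rwa [Real.lt_sqrt (by norm_num), one_pow]
  rcases eigenvalue_of_decaySubmodule_eq_top hd hG h hφ h0 with h1 | h1
  · linarith
  · rw [abs_neg, abs_of_pos (by linarith)] at h1
    nlinarith

/-- The powers of the non-backtracking matrix equidistribute at the rate `n √d ^ n` exactly for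
non-bipartite Ramanujan graphs. -/
theorem decaySubmodule_eq_top_iff [Fintype V(G)] {d : ℕ} (hd : 2 ≤ d)
    (hG : G.IsRegularOfDegree (d + 1)) (hV : V(G).Nonempty) :
    G.decaySubmodule d = ⊤ ↔ G.IsRamanujan d ∧ ¬ G.IsBipartite := by
  refine ⟨fun h => ⟨⟨connected_of_decaySubmodule_eq_top hd hG hV h, hG, fun lam hlam => ?_⟩,
    not_isBipartite_of_decaySubmodule_eq_top hd hG hV h⟩,
    fun h => h.1.decaySubmodule_eq_top (by omega) h.2⟩
  obtain ⟨φ, hφ⟩ := hlam.exists_hasEigenvector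
  have h1 : G.adjMatrix.mulVec φ = lam • φ := Module.End.mem_eigenspace_iff.1 hφ.1
  exact (eigenvalue_of_decaySubmodule_eq_top hd hG h h1 hφ.2).imp_right Or.inr

end Graph

/-! ### Correlations of square integrable functions -/

section Correlation

variable {X : Type*} [MeasurableSpace X] {T : X → X} {μ : Measure X}

/-- The `n`-th correlation coefficient of two functions. -/
noncomputable def correlation (T : X → X) (μ : Measure X) (n : ℕ) (f g : X → ℂ) : ℂ :=
  (∫ x, f (T^[n] x) * g x ∂μ) - (∫ x, f x ∂μ) * ∫ x, g x ∂μ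

theorem MeasureTheory.MeasurePreserving.integrable_iterate_mul (hT : MeasurePreserving T μ μ)
    {f g : X → ℂ} (hf : MemLp f 2 μ) (hg : MemLp g 2 μ) (n : ℕ) :
    Integrable (fun x => f (T^[n] x) * g x) μ :=
  (hf.comp_measurePreserving (hT.iterate n)).integrable_mul hg

theorem norm_integral_mul_le {f g : X → ℂ} (hf : MemLp f 2 μ) (hg : MemLp g 2 μ) :
    ‖∫ x, f x * g x ∂μ‖ ≤ (eLpNorm f 2 μ).toReal * (eLpNorm g 2 μ).toReal := by
  rw [← ENNReal.toReal_mul, ← toReal_enorm]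
  refine ENNReal.toReal_mono (ENNReal.mul_ne_top hf.eLpNorm_ne_top hg.eLpNorm_ne_top) ?_
  refine (enorm_integral_le_lintegral_enorm _).trans ?_
  rw [← eLpNorm_one_eq_lintegral_enorm]
  exact eLpNorm_smul_le_mul_eLpNorm (p := 2) (q := 2) (r := 1) (f := g) (φ := f) hg.1 hf.1

theorem correlation_smul_left (c : ℂ) (f g : X → ℂ) (n : ℕ) :
    correlation T μ n (c • f) g = c * correlation T μ n f g := by
  simp only [correlation, Pi.smul_apply, smul_eq_mul, mul_assoc, integral_const_mul]
  ring

theorem correlation_smul_right (c : ℂ) (f g : X → ℂ) (n : ℕ) :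
    correlation T μ n f (c • g) = c * correlation T μ n f g := by
  simp only [correlation, Pi.smul_apply, smul_eq_mul, mul_left_comm _ c, integral_const_mul]
  ring

variable [IsProbabilityMeasure μ]

theorem norm_integral_le_eLpNorm_two {f : X → ℂ} (hf : MemLp f 2 μ) :
    ‖∫ x, f x ∂μ‖ ≤ (eLpNorm f 2 μ).toReal := by
  rw [← toReal_enorm]
  refine ENNReal.toReal_mono hf.eLpNorm_ne_top ?_
  refine (enorm_integral_le_lintegral_enorm _).trans ?_
  rw [← eLpNorm_one_eq_lintegral_enorm]
  exact eLpNorm_le_eLpNorm_of_exponent_le (by norm_num) hf.1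

namespace MeasureTheory.MeasurePreserving

variable {f f' g g' : X → ℂ}

theorem correlation_add_left (hT : MeasurePreserving T μ μ)
    (hf : MemLp f 2 μ) (hf' : MemLp f' 2 μ) (hg : MemLp g 2 μ) (n : ℕ) :
    correlation T μ n (f + f') g = correlation T μ n f g + correlation T μ n f' g := by
  simp only [correlation, Pi.add_apply, add_mul]
  rw [integral_add (hT.integrable_iterate_mul hf hg n) (hT.integrable_iterate_mul hf' hg n),
    integral_add (hf.integrable (by norm_num)) (hf'.integrable (by norm_num))]
  ring

theorem correlation_add_right (hT : MeasurePreserving T μ μ)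
    (hf : MemLp f 2 μ) (hg : MemLp g 2 μ) (hg' : MemLp g' 2 μ) (n : ℕ) :
    correlation T μ n f (g + g') = correlation T μ n f g + correlation T μ n f g' := by
  simp only [correlation, Pi.add_apply, mul_add]
  rw [integral_add (hT.integrable_iterate_mul hf hg n) (hT.integrable_iterate_mul hf hg' n),
    integral_add (hg.integrable (by norm_num)) (hg'.integrable (by norm_num))]
  ring

/-- Cauchy-Schwarz, with the `L²` norm of `f` unchanged by the iterates. Uniformity in `n` is what
allows approximation in `L²`. -/
theorem norm_correlation_le (hT : MeasurePreserving T μ μ) (hf : MemLp f 2 μ)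
    (hg : MemLp g 2 μ) (n : ℕ) :
    ‖correlation T μ n f g‖ ≤ 2 * ((eLpNorm f 2 μ).toReal * (eLpNorm g 2 μ).toReal) := by
  have h1 := norm_integral_mul_le (hf.comp_measurePreserving (hT.iterate n)) hg
  rw [eLpNorm_comp_measurePreserving hf.1 (hT.iterate n)] at h1
  have h2 := mul_le_mul (norm_integral_le_eLpNorm_two hf) (norm_integral_le_eLpNorm_two hg)
    (norm_nonneg _) ENNReal.toReal_nonneg
  rw [← norm_mul] at h2
  refine (norm_sub_le _ _).trans ((add_le_add h1 h2).trans_eq (two_mul _).symm)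

/-- Strong mixing may be tested on a set of functions which is dense in `L²`. -/
theorem stronglyMixing_of_dense (hT : MeasurePreserving T μ μ)
    {D : Set (X → ℂ)} (hD : ∀ f ∈ D, MemLp f 2 μ)
    (hdense : ∀ f, MemLp f 2 μ → ∀ ε : ℝ, 0 < ε → ∃ f' ∈ D, (eLpNorm (f - f') 2 μ).toReal ≤ ε)
    (hmix : ∀ f ∈ D, ∀ g ∈ D, Tendsto (fun n => correlation T μ n f g) atTop (𝓝 0)) :
    StronglyMixing T μ := by
  intro f g hf hg
  rw [← tendsto_sub_nhds_zero_iff]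
  change Tendsto (fun n => correlation T μ n f g) atTop (𝓝 0)
  rw [Metric.tendsto_atTop]
  intro ε hε
  have hpos : ∀ h : X → ℂ, 0 < 6 * ((eLpNorm h 2 μ).toReal + 1) := fun h => by positivity
  -- The correlation splits into those of `(f - f', g)`, `(f', g - g')` and `(f', g')`, so `f'` is
  -- fitted to the norm of `g`, then `g'` to that of `f'`. The `6` is the factor `2` of the uniform
  -- bound times three pieces.
  obtain ⟨f', hf'D, hf'⟩ := hdense f hf _ (div_pos hε (hpos g))
  obtain ⟨g', hg'D, hg'⟩ := hdense g hg _ (div_pos hε (hpos f'))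
  obtain ⟨N, hN⟩ := Metric.tendsto_atTop.1 (hmix f' hf'D g' hg'D) (ε / 3) (by positivity)
  refine ⟨N, fun n hn => ?_⟩
  have hf'2 := hD f' hf'D
  have hg'2 := hD g' hg'D
  have h1 := hT.norm_correlation_le (hf.sub hf'2) hg n
  have h2 := hT.norm_correlation_le hf'2 (hg.sub hg'2) n
  have h3 := hN n hn
  rw [dist_zero_right] at h3 ⊢
  have hsmall : ∀ (h : X → ℂ) (t : ℝ), t ≤ ε / (6 * ((eLpNorm h 2 μ).toReal + 1)) →
      2 * (t * (eLpNorm h 2 μ).toReal) ≤ ε / 3 := by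
    intro h t ht
    rw [le_div_iff₀ (hpos h)] at ht
    have h0 : 0 ≤ (eLpNorm h 2 μ).toReal := ENNReal.toReal_nonneg
    rcases le_total 0 t with ht0 | ht0
    · nlinarith
    · nlinarith [mul_nonneg (neg_nonneg.2 ht0) h0]
  have h4 := hsmall g _ hf'
  have h5 := hsmall f' _ hg'
  rw [mul_comm (eLpNorm (g - g') 2 μ).toReal] at h5
  have h6 : correlation T μ n f g = correlation T μ n (f - f') g +
      (correlation T μ n f' (g - g') + correlation T μ n f' g') := by
    rw [← hT.correlation_add_right hf'2 (hg.sub hg'2) hg'2, sub_add_cancel,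
      ← hT.correlation_add_left (hf.sub hf'2) hf'2 hg, sub_add_cancel]
  rw [h6]
  have := norm_add_le (correlation T μ n (f - f') g)
    (correlation T μ n f' (g - g') + correlation T μ n f' g')
  have := norm_add_le (correlation T μ n f' (g - g')) (correlation T μ n f' g')
  by_contra! hcon
  linarith

end MeasureTheory.MeasurePreserving

end Correlation

/-! ### Density of locally constant functions -/

section Density

variable {X : Type*} [TopologicalSpace X] [CompactSpace X]

theorem Continuous.memLp_two_of_compactSpace [MeasurableSpace X]
    [BorelSpace X] {μ : Measure X} [IsFiniteMeasure μ] {f : X → ℂ} (hf : Continuous f) : MemLp f 2 μ :=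
  MemLp.of_bound hf.aestronglyMeasurable ‖(⟨f, hf⟩ : C(X, ℂ))‖
    (Eventually.of_forall (ContinuousMap.norm_coe_le_norm (⟨f, hf⟩ : C(X, ℂ))))

variable [T2Space X] [TotallyDisconnectedSpace X]

/-- Stone-Weierstrass: locally constant functions form a star subalgebra, which separates points
because the space is totally disconnected. -/
theorem ContinuousMap.exists_isLocallyConstant_norm_sub_le (f : C(X, ℂ)) {ε : ℝ} (hε : 0 < ε) :
    ∃ h : X → ℂ, IsLocallyConstant h ∧ ∀ x, ‖f x - h x‖ ≤ ε := by
  let S : StarSubalgebra ℂ C(X, ℂ) :=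
    { (LocallyConstant.toContinuousMapAlgHom ℂ : LocallyConstant X ℂ →ₐ[ℂ] C(X, ℂ)).range with
      star_mem' := by
        rintro _ ⟨h, rfl⟩
        exact ⟨h.map star, by ext; rfl⟩ }
  have hS : S.topologicalClosure = ⊤ :=
    ContinuousMap.starSubalgebra_topologicalClosure_eq_top_of_separatesPoints S
      (LocallyConstant.separatesPoints_range_toContinuousMapAlgHom ℂ)
  have hf : f ∈ closure (S : Set C(X, ℂ)) := by
    rw [← StarSubalgebra.topologicalClosure_coe, hS]
    trivial
  obtain ⟨_, ⟨h, rfl⟩, hfh⟩ := Metric.mem_closure_iff.1 hf ε hε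
  refine ⟨h, h.isLocallyConstant, fun x => ?_⟩
  rw [dist_eq_norm] at hfh
  exact (ContinuousMap.norm_coe_le_norm (f - _) x).trans hfh.le

variable [TopologicalSpace.PseudoMetrizableSpace X] [MeasurableSpace X] [BorelSpace X]

theorem MeasureTheory.MemLp.exists_isLocallyConstant_eLpNorm_sub_le {μ : Measure X}
    [IsProbabilityMeasure μ] {f : X → ℂ} (hf : MemLp f 2 μ) {ε : ℝ} (hε : 0 < ε) :
    ∃ h : X → ℂ, IsLocallyConstant h ∧ (eLpNorm (f - h) 2 μ).toReal ≤ ε := by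
  obtain ⟨g, hg, hg2⟩ := hf.exists_boundedContinuous_eLpNorm_sub_le (by norm_num)
    (ε := ENNReal.ofReal (ε / 2)) (by simpa using hε)
  obtain ⟨h, hh, hgh⟩ := ContinuousMap.exists_isLocallyConstant_norm_sub_le (g : C(X, ℂ))
    (half_pos hε)
  refine ⟨h, hh, ENNReal.toReal_le_of_le_ofReal hε.le ?_⟩
  have h1 : eLpNorm (⇑g - h) 2 μ ≤ ENNReal.ofReal (ε / 2) := by
    refine (eLpNorm_le_of_ae_bound (C := ε / 2) (Eventually.of_forall hgh)).trans_eq ?_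
    simp
  have h2 : f - h = (f - ⇑g) + (⇑g - h) := by abel
  rw [h2, ← add_halves ε, ENNReal.ofReal_add (half_pos hε).le (half_pos hε).le]
  exact (eLpNorm_add_le (hf.1.sub hg2.1) (hg2.1.sub hh.continuous.aestronglyMeasurable)
    (by norm_num)).trans (add_le_add hg h1)

end Density

/-! ### Cylinders of a subshift of finite type -/

section Cylinders

variable {V : Type*} {A : Matrix V V ℕ}

theorem sftShift_iterate_apply (n : ℕ) (x : sftSet A) (i : ℤ) :
    ((sftShift A)^[n] x).1 i = x.1 (i + n) := by
  induction n generalizing x with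
  | zero => simp
  | succ n ih =>
    rw [Function.iterate_succ_apply, ih]
    simp only [sftShift]
    rw [Nat.cast_succ, add_assoc]

theorem preimage_sftShift_sftCylinder (n : ℕ) (a : ℤ) (k : ℕ) (w : ℕ → V) :
    (sftShift A)^[n] ⁻¹' sftCylinder A a k w = sftCylinder A (a + n) k w := by
  ext x
  simp only [sftCylinder, Set.mem_preimage, Set.mem_ofPred_eq, sftShift_iterate_apply]
  simp only [add_right_comm]

/-- The points which agree with `x` on `[-K, K]`. -/
def sftWindow (x : sftSet A) (K : ℕ) : Set (sftSet A) :=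
  sftCylinder A (-(K : ℤ)) (K + K) fun i => x.1 (-(K : ℤ) + i)

theorem mem_sftWindow {x y : sftSet A} {K : ℕ} :
    y ∈ sftWindow x K ↔ ∀ i : ℤ, -(K : ℤ) ≤ i → i ≤ K → y.1 i = x.1 i := by
  constructor
  · intro h i h1 h2
    have := h (i + K).toNat (by omega)
    simpa only [show -(K : ℤ) + ((i + K).toNat : ℤ) = i by omega] using this
  · intro h i hi
    exact h _ (by omega) (by omega)

variable [MeasurableSpace V] [MeasurableSingletonClass V] {P : Matrix V V ℝ≥0} {p : V → ℝ≥0}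
  {μ : Measure (sftSet A)}

/-- The Markov property: the mass of a cylinder with a gap of `m` transitions. -/
theorem IsMarkovMeasure.measure_inter [Fintype V] [DecidableEq V] (hμ : IsMarkovMeasure P p μ)
    (m : ℕ) (a : ℤ) (k l : ℕ) (w u : ℕ → V) :
    μ (sftCylinder A a k w ∩ sftCylinder A (a + k + m) l u) =
      (((p (w 0) * ∏ i ∈ Finset.range k, P (w i) (w (i + 1))) * (P ^ m) (w k) (u 0) *
        ∏ i ∈ Finset.range l, P (u i) (u (i + 1)) : ℝ≥0) : ℝ≥0∞) := by
  induction m generalizing k w with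
  | zero =>
    -- Without a gap the two words share the coordinate `a + k`: they glue to one word or are
    -- incompatible, as recorded by the identity matrix `P ^ 0`.
    by_cases h : w k = u 0
    · have hset : sftCylinder A a k w ∩ sftCylinder A (a + k + (0 : ℕ)) l u =
          sftCylinder A a (k + l) fun i => if i ≤ k then w i else u (i - k) := by
        ext x
        simp only [sftCylinder, Set.mem_inter_iff, Set.mem_ofPred_eq]
        constructor
        · rintro ⟨h1, h2⟩ i hi
          split_ifs with hik
          · exact h1 i hik
          · rw [← h2 (i - k) (by omega),
              show a + (k : ℤ) + (0 : ℕ) + ((i - k : ℕ) : ℤ) = a + i by omega]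
        · intro h1
          refine ⟨fun i hi => by simpa [hi] using h1 i (by omega), fun i hi => ?_⟩
          have h2 := h1 (k + i) (by omega)
          rw [show a + ((k + i : ℕ) : ℤ) = a + k + (0 : ℕ) + i by push_cast; ring] at h2
          rw [h2]
          by_cases hi0 : i = 0
          · simp [hi0, h]
          · simp [hi0]
      rw [hset, hμ]
      congr 1
      rw [Finset.prod_range_add]
      simp only [pow_zero, h, Matrix.one_apply_eq, mul_one, Nat.zero_le, if_true]
      rw [mul_assoc]
      congr 2
      · refine Finset.prod_congr rfl fun i hi => ?_
        have := Finset.mem_range.1 hi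
        rw [if_pos (by omega), if_pos (by omega)]
      · refine Finset.prod_congr rfl fun i hi => ?_
        rw [if_neg (by omega : ¬ k + i + 1 ≤ k), show k + i + 1 - k = i + 1 by omega]
        by_cases hi0 : i = 0
        · simp [hi0, h]
        · rw [if_neg (by omega), Nat.add_sub_cancel_left]
    · have hset : sftCylinder A a k w ∩ sftCylinder A (a + k + (0 : ℕ)) l u = ∅ := by
        refine Set.eq_empty_of_forall_notMem fun x hx => h ?_
        have h1 := hx.1 k le_rfl
        have h2 := hx.2 0 (Nat.zero_le _)
        rw [← h1, ← h2]
        simp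
      rw [hset, measure_empty, pow_zero, Matrix.one_apply_ne h]
      simp
  | succ m ih =>
    -- Splitting by the letter `b` after the first word shortens the gap by one and matches `P ^ (m
    -- + 1) = P * P ^ m`.
    set w' : V → ℕ → V := fun b => Function.update w (k + 1) b with hw'
    have hw : ∀ b, ∀ i ≤ k, w' b i = w i := fun b i hi =>
      Function.update_of_ne (by omega) _ _
    have hw1 : ∀ b, w' b (k + 1) = b := fun b => Function.update_self _ _ _
    have hU : sftCylinder A a k w ∩ sftCylinder A (a + k + (m + 1 : ℕ)) l u =
        ⋃ b : V, sftCylinder A a (k + 1) (w' b) ∩ sftCylinder A (a + (k + 1 : ℕ) + m) l u := by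
      have he : a + (k : ℤ) + ((m + 1 : ℕ) : ℤ) = a + (k + 1 : ℕ) + m := by push_cast; ring
      rw [← Set.iUnion_inter, he]
      congr 1
      ext x
      simp only [sftCylinder, Set.mem_ofPred_eq, Set.mem_iUnion]
      constructor
      · intro hx
        refine ⟨x.1 (a + (k + 1 : ℕ)), fun i hi => ?_⟩
        rcases Nat.lt_or_ge k i with h1 | h1
        · obtain rfl : i = k + 1 := by omega
          rw [hw1]
        · rw [hw _ _ h1, hx i h1]
      · rintro ⟨b, hb⟩ i hi
        rw [hb i (by omega), hw _ _ hi]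
    have hdis : Pairwise (Function.onFun Disjoint fun b : V =>
        sftCylinder A a (k + 1) (w' b) ∩ sftCylinder A (a + (k + 1 : ℕ) + m) l u) := by
      intro b c hbc
      refine Set.disjoint_left.2 fun x hx hy => hbc ?_
      rw [← hw1 b, ← hw1 c, ← hx.1 (k + 1) le_rfl, ← hy.1 (k + 1) le_rfl]
    rw [hU, measure_iUnion hdis fun b => (measurableSet_sftCylinder _ _ _).inter
      (measurableSet_sftCylinder _ _ _), tsum_fintype]
    simp only [ih]
    rw [← ENNReal.ofNNReal_finsetSum]
    congr 1
    rw [← Finset.sum_mul]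
    congr 1
    rw [pow_succ', Matrix.mul_apply, Finset.mul_sum]
    refine Finset.sum_congr rfl fun b _ => ?_
    rw [Finset.prod_range_succ, hw1, hw _ 0 (Nat.zero_le _), hw _ k le_rfl]
    rw [Finset.prod_congr rfl (g := fun i => P (w i) (w (i + 1))) fun i hi => by
      have := Finset.mem_range.1 hi
      rw [hw _ i (by omega), hw _ (i + 1) (by omega)]]
    ring

theorem IsMarkovMeasure.measure_univ [Fintype V] (hμ : IsMarkovMeasure P p μ) :
    μ Set.univ = ((∑ b, p b : ℝ≥0) : ℝ≥0∞) := by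
  have hU : (Set.univ : Set (sftSet A)) = ⋃ b : V, sftCylinder A 0 0 fun _ => b := by
    symm
    refine Set.eq_univ_of_forall fun x => Set.mem_iUnion.2 ⟨x.1 0, fun i hi => ?_⟩
    obtain rfl : i = 0 := by omega
    simp
  have hdis : Pairwise (Function.onFun Disjoint fun b : V => sftCylinder A 0 0 fun _ => b) := by
    intro b c hbc
    refine Set.disjoint_left.2 fun x hx hy => hbc ?_
    exact (hx 0 le_rfl).symm.trans (hy 0 le_rfl)
  rw [hU, measure_iUnion hdis fun b => measurableSet_sftCylinder _ _ _, tsum_fintype]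
  simp only [hμ 0 0, Finset.range_zero, Finset.prod_empty, mul_one]
  rw [← ENNReal.ofNNReal_finsetSum]

end Cylinders

/-! ### The topology of a subshift of finite type -/

section Topology

variable {V : Type*} {A : Matrix V V ℕ} [TopologicalSpace V]

theorem continuous_sftShift : Continuous (sftShift A) :=
  Continuous.subtype_mk (f := fun x : sftSet A => fun i => x.1 (i + 1))
    (continuous_pi fun i => (continuous_apply (i + 1)).comp continuous_subtype_val) _

theorem exists_sftWindow_subset (x : sftSet A) {U : Set (sftSet A)} (hU : IsOpen U) (hx : x ∈ U) :
    ∃ K, sftWindow x K ⊆ U := by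
  obtain ⟨W, hW, rfl⟩ := isOpen_induced_iff.1 hU
  obtain ⟨I, s, hs, hsub⟩ := isOpen_pi_iff.1 hW x.1 hx
  refine ⟨I.sup Int.natAbs, fun y hy => hsub fun i hi => ?_⟩
  have h1 : i.natAbs ≤ I.sup Int.natAbs := Finset.le_sup (f := Int.natAbs) hi
  rw [mem_sftWindow.1 hy i (by omega) (by omega)]
  exact (hs i hi).2

variable [DiscreteTopology V]

theorem isClosed_sftSet (A : Matrix V V ℕ) : IsClosed (sftSet A) := by
  have : sftSet A = ⋂ i : ℤ, {x | A (x i) (x (i + 1)) = 1} := by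
    ext
    simp [sftSet]
  rw [this]
  refine isClosed_iInter fun i => ?_
  have hc : Continuous fun x : ℤ → V => (x i, x (i + 1)) := by fun_prop
  exact (isClosed_discrete {q : V × V | A q.1 q.2 = 1}).preimage hc

instance [Finite V] : CompactSpace (sftSet A) :=
  isCompact_iff_compactSpace.1 (isClosed_sftSet A).isCompact

theorem isClopen_sftCylinder (a : ℤ) (k : ℕ) (w : ℕ → V) : IsClopen (sftCylinder A a k w) := by
  have : sftCylinder A a k w =
      ⋂ i ∈ Finset.range (k + 1), {x : sftSet A | x.1 (a + i) = w i} := by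
    ext x
    simp [sftCylinder]
  rw [this]
  refine isClopen_biInter_finset fun i _ => ?_
  have hc : Continuous fun x : sftSet A => x.1 (a + i) :=
    (continuous_apply (a + i : ℤ)).comp continuous_subtype_val
  exact (isClopen_discrete {w i}).preimage hc

/-- Each point has a window on which `f` is constant; compactness leaves finitely many, and the
largest radius works everywhere. -/
theorem IsLocallyConstant.exists_sftWindow [Finite V] {Y : Type*} {f : sftSet A → Y}
    (hf : IsLocallyConstant f) : ∃ K, ∀ x, ∀ y ∈ sftWindow x K, f y = f x := by
  have h1 : ∀ x, ∃ K, sftWindow x K ⊆ f ⁻¹' {f x} := fun x =>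
    exists_sftWindow_subset x (hf.isOpen_fiber (f x)) rfl
  choose K hK using h1
  obtain ⟨t, ht⟩ := isCompact_univ.elim_finite_subcover (fun x => sftWindow x (K x))
    (fun x => (isClopen_sftCylinder _ _ _).isOpen)
    (fun x _ => Set.mem_iUnion.2 ⟨x, mem_sftWindow.2 fun _ _ _ => rfl⟩)
  refine ⟨t.sup K, fun x y hy => ?_⟩
  obtain ⟨z, hz, hxz⟩ := Set.mem_iUnion₂.1 (ht (Set.mem_univ x))
  have hle : K z ≤ t.sup K := Finset.le_sup hz
  have hyz : y ∈ sftWindow z (K z) := mem_sftWindow.2 fun i h2 h3 =>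
    (mem_sftWindow.1 hy i (by omega) (by omega)).trans (mem_sftWindow.1 hxz i h2 h3)
  exact (hK z hyz : f y = f z).trans (hK z hxz : f x = f z).symm

/-- Locally constant functions are linear combinations of indicators of cylinders. -/
theorem IsLocallyConstant.mem_span_sftCylinder [Finite V] {f : sftSet A → ℂ}
    (hf : IsLocallyConstant f) :
    f ∈ Submodule.span ℂ {g | ∃ a k w, g = (sftCylinder A a k w).indicator 1} := by
  classical
  have := Fintype.ofFinite V
  obtain ⟨K, hK⟩ := hf.exists_sftWindow
  let ρ : sftSet A → (Fin (K + K + 1) → V) := fun x i => x.1 (-(K : ℤ) + i)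
  have hρ : ∀ x y, ρ y = ρ x ↔ y ∈ sftWindow x K := by
    intro x y
    constructor
    · exact fun h i hi => congrFun h ⟨i, by omega⟩
    · exact fun h => funext fun i => h i (by omega)
  have hsum : f = ∑ c : Set.range ρ, f c.2.choose •
      (sftWindow c.2.choose K).indicator (1 : sftSet A → ℂ) := by
    ext x
    have hc : ρ (Set.mem_range_self (f := ρ) x).choose = ρ x :=
      (Set.mem_range_self (f := ρ) x).choose_spec
    rw [Finset.sum_apply, Finset.sum_eq_single ⟨ρ x, Set.mem_range_self x⟩]
    · have hx : x ∈ sftWindow (Set.mem_range_self (f := ρ) x).choose K := (hρ _ _).1 hc.symm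
      simp only [Pi.smul_apply, Set.indicator_of_mem hx, Pi.one_apply, smul_eq_mul, mul_one]
      exact hK _ _ hx
    · rintro c _ hne
      have hx : x ∉ sftWindow c.2.choose K := fun hx =>
        hne (Subtype.ext (c.2.choose_spec.symm.trans ((hρ _ _).2 hx).symm))
      simp [Set.indicator_of_notMem hx]
    · simp
  rw [hsum]
  exact Submodule.sum_mem _ fun c _ => Submodule.smul_mem _ _ (Submodule.subset_span ⟨_, _, _, rfl⟩)

theorem continuous_sftCylinder_indicator (a : ℤ) (k : ℕ) (w : ℕ → V) :
    Continuous ((sftCylinder A a k w).indicator (1 : sftSet A → ℂ)) :=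
  (LocallyConstant.charFn ℂ (isClopen_sftCylinder (A := A) a k w)).continuous

end Topology

/-! ### Decay of correlations for Markov measures -/

section Markov

variable {V : Type*} {A : Matrix V V ℕ} [MeasurableSpace V] {P : Matrix V V ℝ≥0} {p : V → ℝ≥0}
  {μ : Measure (sftSet A)}

section

variable [MeasurableSingletonClass V]

theorem integral_sftCylinder_indicator (a : ℤ) (k : ℕ) (w : ℕ → V) :
    ∫ x, (sftCylinder A a k w).indicator (1 : sftSet A → ℂ) x ∂μ =
      (μ.real (sftCylinder A a k w) : ℂ) := by
  rw [integral_indicator (measurableSet_sftCylinder a k w)]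
  simp

theorem correlation_sftCylinder_indicator (n : ℕ) (a b : ℤ) (k l : ℕ) (w u : ℕ → V) :
    correlation (sftShift A) μ n ((sftCylinder A b l u).indicator 1)
        ((sftCylinder A a k w).indicator 1) =
      ((μ.real (sftCylinder A a k w ∩ sftCylinder A (b + n) l u) -
        μ.real (sftCylinder A b l u) * μ.real (sftCylinder A a k w) : ℝ) : ℂ) := by
  rw [correlation, integral_sftCylinder_indicator, integral_sftCylinder_indicator]
  push_cast
  congr 1
  have h : ∀ x : sftSet A, (sftCylinder A b l u).indicator (1 : sftSet A → ℂ) ((sftShift A)^[n] x) *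
      (sftCylinder A a k w).indicator 1 x =
      (sftCylinder A a k w ∩ sftCylinder A (b + n) l u).indicator 1 x := by
    intro x
    rw [← preimage_sftShift_sftCylinder]
    by_cases h1 : x ∈ sftCylinder A a k w <;>
      by_cases h2 : (sftShift A)^[n] x ∈ sftCylinder A b l u <;> simp [h1, h2]
  simp only [h]
  rw [integral_indicator ((measurableSet_sftCylinder a k w).inter
    (measurableSet_sftCylinder (b + n) l u))]
  simp

/-- A rate of convergence for the powers of the transition matrix carries over to cylinders. -/
theorem IsMarkovMeasure.exists_cylinder_decay [Fintype V] [DecidableEq V]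
    [IsProbabilityMeasure μ]
    (hμ : IsMarkovMeasure P p μ) {r C : ℝ} (hr0 : 0 < r) (hr1 : r ≤ 1)
    (hP : ∀ (m : ℕ) (u v : V), |(((P ^ m) u v : ℝ≥0) : ℝ) - p v| ≤ C * (m + 1) * r ^ m)
    (a b : ℤ) (k l : ℕ) (w u : ℕ → V) :
    ∃ D : ℝ, 0 ≤ D ∧ ∀ n : ℕ, 1 ≤ n →
      |μ.real (sftCylinder A a k w ∩ sftCylinder A (b + n) l u) -
        μ.real (sftCylinder A b l u) * μ.real (sftCylinder A a k w)| ≤ D * n * r ^ n := by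
  -- The gap `m = b + n - a - k` differs from `n` by at most `S`. Hence `m + 1 ≤ (S + 2) n`, and `r
  -- ^ m ≤ r ^ n / r ^ S`.
  set S : ℕ := (b - a - k).natAbs with hS
  set α : ℝ≥0 := p (w 0) * ∏ i ∈ Finset.range k, P (w i) (w (i + 1)) with hα
  set γ : ℝ≥0 := ∏ i ∈ Finset.range l, P (u i) (u (i + 1)) with hγ
  have hαμ : ∀ a, μ.real (sftCylinder A a k w) = α := fun a => by
    rw [Measure.real, hμ, ENNReal.coe_toReal]
  have hγμ : μ.real (sftCylinder A b l u) = p (u 0) * γ := by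
    rw [Measure.real, hμ, ENNReal.coe_toReal, NNReal.coe_mul]
  have hC : 0 ≤ C := by
    have := (abs_nonneg _).trans (hP 0 (w 0) (w 0))
    simpa using this
  have hrS : 0 < r ^ S := pow_pos hr0 S
  refine ⟨(α * γ * C * (S + 2) + 1) / r ^ S, by positivity, fun n hn => ?_⟩
  have hn1 : (1 : ℝ) ≤ n := by exact_mod_cast hn
  rw [div_mul_eq_mul_div, div_mul_eq_mul_div, le_div_iff₀ hrS]
  by_cases hcase : 0 ≤ b + n - a - k
  · obtain ⟨m, hm⟩ := Int.eq_ofNat_of_zero_le hcase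
    have he : b + n = a + k + m := by omega
    rw [he, hγμ, hαμ, Measure.real, hμ.measure_inter, ENNReal.coe_toReal]
    rw [← hα, ← hγ]
    push_cast
    have h1 : (α : ℝ) * ((P ^ m) (w k) (u 0) : ℝ≥0) * γ - p (u 0) * γ * α =
        α * γ * (((P ^ m) (w k) (u 0) : ℝ≥0) - p (u 0)) := by ring
    rw [h1, abs_mul, abs_of_nonneg (by positivity : (0 : ℝ) ≤ α * γ)]
    have h2 := hP m (w k) (u 0)
    have h3 : r ^ m * r ^ S ≤ r ^ n := by
      rw [← pow_add]
      exact pow_le_pow_of_le_one hr0.le hr1 (by omega)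
    have h4 : (m : ℝ) + 1 ≤ (S + 2) * n := by
      have h5 : (m : ℝ) ≤ n + S := by exact_mod_cast (by omega : m ≤ n + S)
      nlinarith [S.cast_nonneg (α := ℝ)]
    calc (α : ℝ) * γ * |(((P ^ m) (w k) (u 0) : ℝ≥0) : ℝ) - p (u 0)| * r ^ S
        ≤ α * γ * (C * (m + 1) * r ^ m) * r ^ S := by gcongr
      _ = α * γ * C * ((m + 1) * (r ^ m * r ^ S)) := by ring
      _ ≤ α * γ * C * ((S + 2) * n * r ^ n) := by gcongr
      _ = α * γ * C * (S + 2) * n * r ^ n := by ring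
      _ ≤ (α * γ * C * (S + 2) + 1) * n * r ^ n := by
        gcongr
        linarith
  -- A negative gap only occurs for `n < S`. The trivial bound `1` then suffices, paid for by the `+
  -- 1` in the constant.
  · have hle : |μ.real (sftCylinder A a k w ∩ sftCylinder A (b + n) l u) -
        μ.real (sftCylinder A b l u) * μ.real (sftCylinder A a k w)| ≤ 1 := by
      refine abs_sub_le_of_nonneg_of_le measureReal_nonneg measureReal_le_one (by positivity) ?_
      exact mul_le_one₀ measureReal_le_one measureReal_nonneg measureReal_le_one
    have h3 : r ^ S ≤ r ^ n := pow_le_pow_of_le_one hr0.le hr1 (by omega)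
    have h4 : 0 ≤ (α : ℝ) * γ * C * (S + 2) := by positivity
    calc _ ≤ 1 * r ^ S := by gcongr
      _ ≤ 1 * 1 * r ^ n := by linarith
      _ ≤ (α * γ * C * (S + 2) + 1) * n * r ^ n := by
        gcongr
        linarith

end

variable [Fintype V] [TopologicalSpace V] [DiscreteTopology V] [DiscreteMeasurableSpace V]

theorem IsMarkovMeasure.integral_comp_sftShift [IsFiniteMeasure μ] (hμ : IsMarkovMeasure P p μ)
    {f : sftSet A → ℂ} (hf : IsLocallyConstant f) :
    ∫ x, f (sftShift A x) ∂μ = ∫ x, f x ∂μ := by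
  -- Continuity is carried through the span induction to supply integrability when sums are split.
  suffices h : Continuous f ∧ ∫ x, f (sftShift A x) ∂μ = ∫ x, f x ∂μ from h.2
  have hint : ∀ g : sftSet A → ℂ, Continuous g → Integrable g μ := fun g hg =>
    hg.memLp_two_of_compactSpace.integrable (by norm_num)
  have hspan := hf.mem_span_sftCylinder
  clear hf
  induction hspan using Submodule.span_induction with
  | mem g hg =>
    obtain ⟨a, k, w, rfl⟩ := hg
    refine ⟨continuous_sftCylinder_indicator a k w, ?_⟩
    have h1 : ∀ x, (sftCylinder A a k w).indicator (1 : sftSet A → ℂ) (sftShift A x) =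
        (sftCylinder A (a + 1) k w).indicator 1 x := by
      intro x
      have := preimage_sftShift_sftCylinder (A := A) 1 a k w
      rw [Function.iterate_one, Nat.cast_one] at this
      rw [← this]
      rfl
    simp only [h1]
    rw [integral_sftCylinder_indicator, integral_sftCylinder_indicator, Measure.real, Measure.real,
      hμ, hμ]
  | zero => exact ⟨continuous_const, by simp⟩
  | add g h _ _ hg hh =>
    refine ⟨hg.1.add hh.1, ?_⟩
    simp only [Pi.add_apply]
    rw [integral_add (f := fun x => g (sftShift A x)) (g := fun x => h (sftShift A x))
      (hint _ (hg.1.comp continuous_sftShift)) (hint _ (hh.1.comp continuous_sftShift)),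
      integral_add (hint _ hg.1) (hint _ hh.1), hg.2, hh.2]
  | smul c g _ hg =>
    refine ⟨hg.1.const_smul c, ?_⟩
    simp only [Pi.smul_apply, integral_smul, hg.2]

/-- The mass of a cylinder does not depend on its position. This passes to clopen sets through their
locally constant indicators, and clopen sets are a π-system generating the Borel sets. -/
theorem IsMarkovMeasure.measurePreserving_sftShift [IsFiniteMeasure μ]
    (hμ : IsMarkovMeasure P p μ) : MeasurePreserving (sftShift A) μ μ := by
  have hm : Measurable (sftShift A) := continuous_sftShift.measurable
  refine ⟨hm, ?_⟩
  have hs : ∀ s : Set (sftSet A), IsClopen s → μ.map (sftShift A) s = μ s := by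
    intro s hs
    rw [Measure.map_apply hm hs.isOpen.measurableSet]
    have h : ∫ x, (sftShift A ⁻¹' s).indicator (1 : sftSet A → ℂ) x ∂μ =
        ∫ x, s.indicator (1 : sftSet A → ℂ) x ∂μ :=
      hμ.integral_comp_sftShift (LocallyConstant.charFn ℂ hs).isLocallyConstant
    rw [integral_indicator (hm hs.isOpen.measurableSet), integral_indicator hs.isOpen.measurableSet] at h
    simp only [Pi.one_apply, integral_const, Complex.real_smul, mul_one,
      measureReal_restrict_apply_univ, Complex.ofReal_inj] at h
    exact (measureReal_eq_measureReal_iff).1 h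
  refine ext_of_generate_finite {s | IsClopen s} ?_ ?_ (fun s h => hs s h) ?_
  · rw [← (isTopologicalBasis_isClopen (X := sftSet A)).borel_eq_generateFrom]
    exact BorelSpace.measurable_eq
  · exact fun s hs t ht _ => hs.inter ht
  · exact hs _ isClopen_univ

/-- Correlations are bilinear and locally constant functions are spanned by cylinder indicators, so
an induction in `f` and then in `g` reduces to `exists_cylinder_decay`. -/
theorem IsMarkovMeasure.exists_correlation_le [DecidableEq V] [IsProbabilityMeasure μ]
    (hμ : IsMarkovMeasure P p μ) {r C : ℝ} (hr0 : 0 < r) (hr1 : r ≤ 1)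
    (hP : ∀ (m : ℕ) (u v : V), |(((P ^ m) u v : ℝ≥0) : ℝ) - p v| ≤ C * (m + 1) * r ^ m)
    {f g : sftSet A → ℂ} (hf : IsLocallyConstant f) (hg : IsLocallyConstant g) :
    ∃ D : ℝ, 0 ≤ D ∧ ∀ n : ℕ, 1 ≤ n →
      ‖correlation (sftShift A) μ n f g‖ ≤ D * n * r ^ n := by
  have hT := hμ.measurePreserving_sftShift
  have hL : ∀ h : sftSet A → ℂ, Continuous h → MemLp h 2 μ := fun h hh =>
    hh.memLp_two_of_compactSpace
  suffices h : Continuous f ∧ ∃ D : ℝ, 0 ≤ D ∧ ∀ n : ℕ, 1 ≤ n →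
      ‖correlation (sftShift A) μ n f g‖ ≤ D * n * r ^ n from h.2
  have hgL := hL g hg.continuous
  have hspan := hf.mem_span_sftCylinder
  clear hf
  induction hspan using Submodule.span_induction with
  | zero => exact ⟨continuous_const, 0, le_rfl, fun n _ => by simp [correlation]⟩
  | add f f' _ _ hf hf' =>
    obtain ⟨hfc, D, hD0, hD⟩ := hf
    obtain ⟨hfc', D', hD0', hD'⟩ := hf'
    refine ⟨hfc.add hfc', D + D', add_nonneg hD0 hD0', fun n hn => ?_⟩
    rw [hT.correlation_add_left (hL _ hfc) (hL _ hfc') hgL]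
    exact (norm_add_le _ _).trans ((add_le_add (hD n hn) (hD' n hn)).trans_eq (by ring))
  | smul c f _ hf =>
    obtain ⟨hfc, D, hD0, hD⟩ := hf
    refine ⟨hfc.const_smul c, ‖c‖ * D, by positivity, fun n hn => ?_⟩
    rw [correlation_smul_left, norm_mul]
    exact (mul_le_mul_of_nonneg_left (hD n hn) (norm_nonneg c)).trans_eq (by ring)
  | mem f hf =>
    obtain ⟨b, l, u, rfl⟩ := hf
    have hfc := continuous_sftCylinder_indicator (A := A) b l u
    refine ⟨hfc, ?_⟩
    suffices h : Continuous g ∧ ∃ D : ℝ, 0 ≤ D ∧ ∀ n : ℕ, 1 ≤ n →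
      ‖correlation (sftShift A) μ n ((sftCylinder A b l u).indicator 1) g‖ ≤ D * n * r ^ n from h.2
    have hspan := hg.mem_span_sftCylinder
    clear hgL hg
    induction hspan using Submodule.span_induction with
    | zero => exact ⟨continuous_const, 0, le_rfl, fun n _ => by simp [correlation]⟩
    | add g g' _ _ hg hg' =>
      obtain ⟨hgc, D, hD0, hD⟩ := hg
      obtain ⟨hgc', D', hD0', hD'⟩ := hg'
      refine ⟨hgc.add hgc', D + D', add_nonneg hD0 hD0', fun n hn => ?_⟩
      rw [hT.correlation_add_right (hL _ hfc) (hL _ hgc) (hL _ hgc')]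
      exact (norm_add_le _ _).trans ((add_le_add (hD n hn) (hD' n hn)).trans_eq (by ring))
    | smul c g _ hg =>
      obtain ⟨hgc, D, hD0, hD⟩ := hg
      refine ⟨hgc.const_smul c, ‖c‖ * D, by positivity, fun n hn => ?_⟩
      rw [correlation_smul_right, norm_mul]
      exact (mul_le_mul_of_nonneg_left (hD n hn) (norm_nonneg c)).trans_eq (by ring)
    | mem g hg =>
      obtain ⟨a, k, w, rfl⟩ := hg
      refine ⟨continuous_sftCylinder_indicator a k w, ?_⟩
      obtain ⟨D, hD0, hD⟩ := hμ.exists_cylinder_decay hr0 hr1 hP a b k l w u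
      refine ⟨D, hD0, fun n hn => ?_⟩
      rw [correlation_sftCylinder_indicator, Complex.norm_real, Real.norm_eq_abs]
      exact hD n hn

theorem IsMarkovMeasure.stronglyMixing [DecidableEq V] [IsProbabilityMeasure μ]
    (hμ : IsMarkovMeasure P p μ) {r C : ℝ} (hr0 : 0 < r) (hr1 : r < 1)
    (hP : ∀ (m : ℕ) (u v : V), |(((P ^ m) u v : ℝ≥0) : ℝ) - p v| ≤ C * (m + 1) * r ^ m) :
    StronglyMixing (sftShift A) μ := by
  refine hμ.measurePreserving_sftShift.stronglyMixing_of_dense (D := {f | IsLocallyConstant f})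
    (fun f hf => hf.continuous.memLp_two_of_compactSpace)
    (fun f hf ε hε => hf.exists_isLocallyConstant_eLpNorm_sub_le hε) fun f hf g hg => ?_
  obtain ⟨D, hD0, hD⟩ := hμ.exists_correlation_le hr0 hr1.le hP hf hg
  have hlim := (tendsto_self_mul_const_pow_of_abs_lt_one
    (by rwa [abs_of_pos hr0] : |r| < 1)).const_mul D
  rw [mul_zero] at hlim
  refine squeeze_zero_norm' ?_ hlim
  filter_upwards [eventually_ge_atTop 1] with n hn
  exact (hD n hn).trans_eq (mul_assoc _ _ _)

end Markov

/-! ### The transition matrix of the edge shift -/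

namespace Graph

variable {α β : Type*} {G : Graph α β} [Fintype E(G)]

open Classical in
/-- The powers of the stochastic matrix of the edge shift. -/
theorem coe_transition_pow (G : Graph α β) [Fintype E(G)] (d n : ℕ) (e f : G.OrientedEdge) :
    ((((Matrix.of fun u v => (G.nonBacktrackingMatrix u v : ℝ≥0) / d : Matrix _ _ ℝ≥0) ^ n) e f :
      ℝ≥0) : ℝ) = (G.realNonBacktrackingMatrix ^ n) e f / d ^ n := by
  have h1 : NNReal.toRealHom.mapMatrix
      (Matrix.of fun u v => (G.nonBacktrackingMatrix u v : ℝ≥0) / d) =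
      (d : ℝ)⁻¹ • G.realNonBacktrackingMatrix := by
    ext u v
    simp [realNonBacktrackingMatrix, div_eq_inv_mul]
  have h2 : ((NNReal.toRealHom.mapMatrix
      (Matrix.of fun u v => (G.nonBacktrackingMatrix u v : ℝ≥0) / d)) ^ n) e f =
      (((d : ℝ)⁻¹ • G.realNonBacktrackingMatrix) ^ n) e f := by rw [h1]
  rw [← map_pow, smul_pow, RingHom.mapMatrix_apply, Matrix.map_apply, Matrix.smul_apply,
    smul_eq_mul, inv_pow, ← div_eq_inv_mul] at h2
  exact h2

open Classical in
-- Applied to the basis vector at `f`, whose mean is `1 / N`, the powers of the matrix give their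
-- columns. Decay on a basis is decay on the whole space, and division by `d ^ n` turns `√d ^ n`
-- into `(1 / √d) ^ n`.
theorem decaySubmodule_eq_top_iff_exists {d : ℕ} (hd : 1 ≤ d) :
    G.decaySubmodule d = ⊤ ↔ ∃ C : ℝ, ∀ (n : ℕ) (e f : G.OrientedEdge),
      |(((((Matrix.of fun u v => (G.nonBacktrackingMatrix u v : ℝ≥0) / d : Matrix _ _ ℝ≥0) ^ n) e f :
        ℝ≥0) : ℝ)) - (((Fintype.card G.OrientedEdge : ℝ≥0)⁻¹ : ℝ≥0) : ℝ)| ≤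
          C * (n + 1) * (1 / √(d : ℝ)) ^ n := by
  have hd0 : (0 : ℝ) < d := by exact_mod_cast hd
  have hr0 : 0 < √(d : ℝ) := Real.sqrt_pos.2 hd0
  have hr : ∀ n : ℕ, √(d : ℝ) ^ n / d ^ n = (1 / √(d : ℝ)) ^ n := fun n => by
    rw [← div_pow, Real.sqrt_div_self']
  have key : ∀ (C : ℝ) (n : ℕ) (e f : G.OrientedEdge),
      (|((G.realNonBacktrackingMatrix ^ n).mulVec (Pi.single f 1)) e -
        d ^ n * ((∑ x, (Pi.single f 1 : G.OrientedEdge → ℝ) x) / Fintype.card G.OrientedEdge)| ≤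
          C * (n + 1) * √d ^ n) ↔
      |(((((Matrix.of fun u v => (G.nonBacktrackingMatrix u v : ℝ≥0) / d : Matrix _ _ ℝ≥0) ^ n) e f :
        ℝ≥0) : ℝ)) - (((Fintype.card G.OrientedEdge : ℝ≥0)⁻¹ : ℝ≥0) : ℝ)| ≤
          C * (n + 1) * (1 / √(d : ℝ)) ^ n := by
    intro C n e f
    have hdn : 0 < (d : ℝ) ^ n := pow_pos hd0 n
    rw [coe_transition_pow, ← hr, Matrix.mulVec_single_one, Finset.sum_pi_single',
      ← mul_div_assoc (C * (n + 1)) (√(d : ℝ) ^ n), le_div_iff₀ hdn, ← abs_of_pos hdn, ← abs_mul, abs_of_pos hdn, sub_mul, div_mul_cancel₀ _ hdn.ne']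
    simp [Matrix.col, div_eq_inv_mul, mul_comm]
  constructor
  · intro h
    have h1 : ∀ f : G.OrientedEdge, (Pi.single f 1 : G.OrientedEdge → ℝ) ∈ G.decaySubmodule d :=
      fun f => h ▸ Submodule.mem_top
    choose C hC using fun f => mem_decaySubmodule.1 (h1 f)
    refine ⟨∑ f, |C f|, fun n e f => ?_⟩
    refine ((key (C f) n e f).1 (hC f n e)).trans ?_
    have : C f ≤ ∑ f, |C f| := (le_abs_self _).trans
      (Finset.single_le_sum (f := fun f => |C f|) (fun _ _ => abs_nonneg _) (Finset.mem_univ f))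
    gcongr
  · rintro ⟨C, hC⟩
    rw [eq_top_iff, ← (Pi.basisFun ℝ G.OrientedEdge).span_eq, Submodule.span_le]
    rintro _ ⟨f, rfl⟩
    rw [Pi.basisFun_apply]
    exact mem_decaySubmodule.2 ⟨C, fun n e => (key C n e f).2 (hC n e f)⟩

end Graph

/-! ### The equivalence -/

theorem mainTheorem6 {α β : Type*} (G : Graph α β) [Fintype V(G)] [Fintype E(G)]
    (hV : V(G).Nonempty) (d : ℕ) (hd : 2 ≤ d) (hG : G.IsRegularOfDegree (d + 1)) :
    (StronglyMixing G.edgeShift (G.edgeMeasure d) ∧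
      ∀ f g : G.edgeSubshift → ℂ, IsLocallyConstant f → IsLocallyConstant g →
        ∃ C : ℝ, 0 < C ∧ ∀ n : ℕ, 1 ≤ n →
          ‖(∫ x, f (G.edgeShift^[n] x) * g x ∂G.edgeMeasure d) -
              (∫ x, f x ∂G.edgeMeasure d) * ∫ x, g x ∂G.edgeMeasure d‖ ≤
            C * n * (1 / √(d : ℝ)) ^ n) ↔
    (G.IsRamanujan d ∧ ¬ G.IsBipartite) := by
  classical
  have hμ := G.isUniformMarkovMeasure_edgeMeasure (by omega : 0 < d) hV hG
  obtain ⟨v, hv⟩ := hV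
  obtain ⟨a₀, -⟩ := Graph.exists_src_eq hG ⟨v, hv⟩
  have hne : Nonempty G.OrientedEdge := ⟨a₀⟩
  have hN : 0 < (Fintype.card G.OrientedEdge : ℝ) := by exact_mod_cast Fintype.card_pos
  have hprob : IsProbabilityMeasure (G.edgeMeasure d) := ⟨by
    rw [IsMarkovMeasure.measure_univ hμ]
    simp⟩
  have hd1 : (1 : ℝ) < d := by exact_mod_cast hd
  have hs1 : 1 < √(d : ℝ) := by rwa [Real.lt_sqrt (by norm_num), one_pow]
  have hr0 : 0 < 1 / √(d : ℝ) := by positivity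
  have hr1 : 1 / √(d : ℝ) < 1 := by rwa [div_lt_one (by positivity)]
  rw [← Graph.decaySubmodule_eq_top_iff hd hG ⟨v, hv⟩,
    Graph.decaySubmodule_eq_top_iff_exists (by omega)]
  constructor
  · rintro ⟨-, h⟩
    have hdecay : ∀ e f : G.OrientedEdge, ∃ C : ℝ, 0 < C ∧ ∀ n : ℕ, 1 ≤ n →
        ‖correlation (sftShift G.nonBacktrackingMatrix) (G.edgeMeasure d) n
          ((sftCylinder G.nonBacktrackingMatrix 0 0 fun _ => f).indicator 1)
          ((sftCylinder G.nonBacktrackingMatrix 0 0 fun _ => e).indicator 1)‖ ≤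
            C * n * (1 / √(d : ℝ)) ^ n := fun e f =>
      h _ _ (LocallyConstant.charFn ℂ (isClopen_sftCylinder 0 0 fun _ => f)).isLocallyConstant
        (LocallyConstant.charFn ℂ (isClopen_sftCylinder 0 0 fun _ => e)).isLocallyConstant
    choose C hC0 hC using hdecay
    -- The cardinality cancels the mass of the first letter, and the `+ 1` covers `n = 0`, where the
    -- assumed rate says nothing.
    refine ⟨∑ e, ∑ f, Fintype.card G.OrientedEdge * C e f + 1, fun n e f => ?_⟩
    have hCle : Fintype.card G.OrientedEdge * C e f ≤
        ∑ e, ∑ f, Fintype.card G.OrientedEdge * C e f := by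
      have hnn : ∀ e f, 0 ≤ Fintype.card G.OrientedEdge * C e f := fun e f =>
        mul_nonneg hN.le (hC0 e f).le
      exact (Finset.single_le_sum (f := fun f => Fintype.card G.OrientedEdge * C e f)
        (fun f _ => hnn e f) (Finset.mem_univ f)).trans
        (Finset.single_le_sum (f := fun e => ∑ f, Fintype.card G.OrientedEdge * C e f)
          (fun e _ => Finset.sum_nonneg fun f _ => hnn e f) (Finset.mem_univ e))
    have hCpos : 0 < Fintype.card G.OrientedEdge * C e f := mul_pos hN (hC0 e f)
    rcases Nat.eq_zero_or_pos n with rfl | hn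
    · have hN1 : (Fintype.card G.OrientedEdge : ℝ)⁻¹ ≤ 1 :=
        inv_le_one_of_one_le₀ (by exact_mod_cast Fintype.card_pos)
      have hN0 : 0 ≤ (Fintype.card G.OrientedEdge : ℝ)⁻¹ := inv_nonneg.2 hN.le
      have : |(((1 : Matrix G.OrientedEdge G.OrientedEdge ℝ≥0) e f : ℝ≥0) : ℝ) -
          (((Fintype.card G.OrientedEdge : ℝ≥0)⁻¹ : ℝ≥0) : ℝ)| ≤ 1 := by
        rw [Matrix.one_apply, NNReal.coe_inv, NNReal.coe_natCast]
        split_ifs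
        · rw [NNReal.coe_one, abs_of_nonneg (by linarith)]
          linarith
        · rw [NNReal.coe_zero, zero_sub, abs_neg, abs_of_nonneg hN0]
          exact hN1
      simp only [pow_zero, Nat.cast_zero, zero_add, mul_one]
      linarith
    · have h1 := hC e f n hn
      -- For one-letter words the gap is exactly `n`, so the correlation is an entry of the `n`-th
      -- power minus `1 / N`, all times `1 / N`.
      have h2 := hμ.measure_inter n 0 0 0 (fun _ => e) (fun _ => f)
      rw [correlation_sftCylinder_indicator, Complex.norm_real, Real.norm_eq_abs, Measure.real,
        Measure.real, Measure.real, hμ, hμ, show (0 : ℤ) + (n : ℤ) = 0 + (0 : ℕ) + n by simp, h2] at h1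
      simp only [Finset.range_zero, Finset.prod_empty, mul_one, ENNReal.coe_toReal, NNReal.coe_mul,
        NNReal.coe_inv, NNReal.coe_natCast, ← mul_sub] at h1
      rw [abs_mul, abs_of_pos (inv_pos.2 hN), inv_mul_le_iff₀ hN] at h1
      rw [NNReal.coe_inv, NNReal.coe_natCast]
      refine h1.trans ?_
      rw [← mul_assoc, ← mul_assoc]
      gcongr <;> linarith
  · rintro ⟨C, hP⟩
    refine ⟨IsMarkovMeasure.stronglyMixing hμ hr0 hr1 hP, fun f g hf hg => ?_⟩
    obtain ⟨D, hD0, hD⟩ := IsMarkovMeasure.exists_correlation_le hμ hr0 hr1.le hP hf hg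
    refine ⟨D + 1, by positivity, fun n hn => (hD n hn).trans ?_⟩
    gcongr
    linarith
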